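/- Let $F_n$ be the free group on the free basis $X=\{x_1,\dots,x_n\}$, and for a word $w$ on $X^{\pm1}$ let $w^{\mathrm{rev}}$ be the word read backwards. Let $\Pi A_n\le \mathrm{Aut}(F_n)$ be the palindromic automorphism group, i.e. the group of automorphisms taking each $x_i$ to an element that can be written as a palindrome on $X^{\pm1}$ (a word $w$ with $w^{\mathrm{rev}}=w$), and let $\mathcal{PI}_n\le \Pi A_n$ be the palindromic Torelli group, i.e. the subgroup of those elements of $\Pi A_n$ that act trivially on the abelianisation of $F_n$. For $i\ne j$ let $P_{ij}$ send $x_i\mapsto x_jx_ix_j$ and fix the other $x_k$; let $\iota_i$ send $x_i\mapsto x_i^{-1}$ and fix the other $x_k$; let $\mathrm{P}\Pi A_n$ be the group generated by all $P_{ij}$ and $\iota_i$. Write $[g,h]=ghg^{-1}h^{-1}$ and compose automorphisms from right to left. An element $\phi\in\mathcal{PI}_n$ is a doubled commutator transvection if there are $\alpha\in\Pi A_n$ and distinct members $y_1,y_2,y_3$ of $Y=\alpha(X)$ such that $\phi(y_1)=[y_2,y_3]^{\mathrm{rev}}\,y_1\,[y_2,y_3]$ and $\phi$ fixes the other members of $Y$.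 Let $\mathcal D_n$ be the group generated by the doubled commutator transvections. **Proposition.** Let $n\ge 3$. Then $\mathcal D_n$ is a proper subgroup of $\mathcal{PI}_n$. More precisely, let $W=\langle A,B\mid A^2=B^2=1\rangle$ be the free Coxeter group of rank $2$, and let $i,j,k\in\{1,\dots,n\}$ be pairwise distinct (for instance $1,2,3$). Then: 1. The separating $\pi$-twist $\chi_2=(P_{jk}P_{ik}^{-1}P_{ki}P_{kj}P_{ij}P_{ji}^{-1})^2$ lies in $\mathcal{PI}_n$ but not in $\mathcal D_n$. 2. There is a surjective homomorphism $\rho:\mathrm{P}\Pi A_n\to W$ that is trivial on $\mathcal D_n\cap \mathrm{P}\Pi A_n$, with $\rho(P_{ji})=A$, $\rho(P_{ij})=B$, with all other $P_{ab}$ and all $\iota_a$ mapped to $1$, and with $\rho(\chi_2)\neq 1$. 3. Let $Q_n$ be the group with generators $S_{ab}$, $O_a$ $(1\le a\ne b\le n)$ and the relators $(1)$ $O_a^2$, $(2)$ $[O_a,O_b]$, $(3)$ $(O_aS_{ab})^2$, $(4)$ $(O_bS_{ab})^2$, $(5)$ $[O_a,S_{bc}]$, $(6)$ $[S_{ca},S_{cb}]$,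 $(7)$ $[S_{ab},S_{cd}]$, $(8)$ $[S_{ba},S_{ca}]$, $(9)$ $[S_{cb},S_{ba}]S_{ca}^{-2}$, where $a,b,c,d$ are pairwise different (so there is no relator $(7)$ for $n=3$), but without the relators $(10)$ $(S_{ab}S_{ac}^{-1}S_{ca}S_{ba}S_{bc}S_{cb}^{-1})^2$. There is a surjective homomorphism $\sigma:Q_n\to W$ with $\sigma(S_{ij})=A$, $\sigma(S_{ji})=B$, with all other $S_{ab}$ and all $O_a$ mapped to $1$, and with $\sigma(\xi)\ne1$, where $\xi=(S_{kj}S_{ki}^{-1}S_{ik}S_{jk}S_{ji}S_{ij}^{-1})^2$ is a word of type $(10)$ corresponding to $\chi_2$ under $P_{ab}\leftrightarrow S_{ba}$. In particular $\xi\neq 1$ in $Q_n$. -/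

import Mathlib

namespace PalTorelli

open scoped commutatorElement

/-- The free group `F_n` on the fixed free basis `x_i = FreeGroup.of i`, `i : Fin n`. -/
abbrev F (n : ℕ) : Type := FreeGroup (Fin n)

/-- The reverse `g ^ rev` of an element of `F_n`: the anti-automorphism of `F_n` that fixes every
member of the basis. On words it reverses the order of the letters, see `rev_mk`. -/
def rev {n : ℕ} (g : F n) : F n :=
  (FreeGroup.lift (fun i : Fin n => MulOpposite.op (FreeGroup.of i)) g).unop

theorem rev_mul {n : ℕ} (g h : F n) : rev (g * h) = rev h * rev g := by
  simp [rev]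

theorem rev_inv {n : ℕ} (g : F n) : rev g⁻¹ = (rev g)⁻¹ := by
  simp [rev]

theorem rev_of {n : ℕ} (i : Fin n) : rev (FreeGroup.of i) = FreeGroup.of i := by
  simp [rev]

theorem rev_one {n : ℕ} : rev (1 : F n) = 1 := by
  simp [rev]

theorem rev_mk {n : ℕ} (L : List (Fin n × Bool)) :
    rev (FreeGroup.mk L) = FreeGroup.mk L.reverse := by
  induction L with
  | nil => exact rev_one
  | cons a L ih =>
    have h1 : (FreeGroup.mk (a :: L) : F n) = FreeGroup.mk [a] * FreeGroup.mk L := by simp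
    have h2 : (FreeGroup.mk (a :: L).reverse : F n)
        = FreeGroup.mk L.reverse * FreeGroup.mk [a] := by simp
    have h3 : rev (FreeGroup.mk [a] : F n) = FreeGroup.mk [a] := by
      obtain ⟨i, b⟩ := a
      cases b with
      | true => exact rev_of i
      | false =>
        have h4 : (FreeGroup.mk [(i, false)] : F n) = (FreeGroup.of i)⁻¹ := by
          simp [FreeGroup.of, FreeGroup.inv_mk, FreeGroup.invRev]
        rw [h4, rev_inv, rev_of]
    rw [h1, rev_mul, ih, h2, h3]

/-- `g` may be written as a palindrome on the letters `x_i`, `x_i⁻¹`. -/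
def IsPalindrome {n : ℕ} (g : F n) : Prop :=
  ∃ L : List (Fin n × Bool), L.Palindrome ∧ FreeGroup.mk L = g

theorem isPalindrome_iff {n : ℕ} (g : F n) : IsPalindrome g ↔ rev g = g := by
  constructor
  · rintro ⟨L, hL, rfl⟩
    rw [rev_mk, hL.reverse_eq]
  · intro h
    refine ⟨g.toWord, List.Palindrome.of_reverse_eq ?_, FreeGroup.mk_toWord⟩
    have hred : FreeGroup.IsReduced g.toWord.reverse := by
      have h0 : FreeGroup.IsReduced g.toWord := FreeGroup.isReduced_toWord
      unfold FreeGroup.IsReduced at h0 ⊢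
      rw [List.isChain_reverse]
      exact h0.imp (fun a b hab e => (hab e.symm).symm)
    have h5 : FreeGroup.mk g.toWord.reverse = g := by
      rw [← rev_mk, FreeGroup.mk_toWord, h]
    have h6 := congrArg FreeGroup.toWord h5
    rw [FreeGroup.toWord_mk, hred.reduce_eq] at h6
    exact h6

/-- If `α` maps the basis to palindromes, then it commutes with reversal. -/
theorem rev_map {n : ℕ} (α : MulAut (F n))
    (h : ∀ i, IsPalindrome (α (FreeGroup.of i))) (g : F n) : rev (α g) = α (rev g) := by
  induction g using FreeGroup.induction_on with
  | C1 => simp [rev_one]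
  | of i => rw [rev_of]; exact (isPalindrome_iff _).1 (h i)
  | inv_of i hi => rw [map_inv, rev_inv, rev_inv, map_inv, hi]
  | mul x y hx hy => rw [map_mul, rev_mul, rev_mul, map_mul, hx, hy]

/-- The palindromic automorphism group `ΠA_n`: the automorphisms of `F_n` that take each member of
the basis to a palindrome. -/
def palAut (n : ℕ) : Subgroup (MulAut (F n)) where
  carrier := {α | ∀ i, IsPalindrome (α (FreeGroup.of i))}
  one_mem' := fun i => (isPalindrome_iff _).2 (rev_of i)
  mul_mem' := by
    intro α β hα hβ i
    rw [isPalindrome_iff, MulAut.mul_apply, rev_map α hα, (isPalindrome_iff _).1 (hβ i)]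
  inv_mem' := by
    intro α hα i
    rw [isPalindrome_iff]
    apply α.injective
    rw [← rev_map α hα, MulAut.apply_inv_self, rev_of]

/-- The palindromic Torelli group `PI_n`: the elements of `ΠA_n` that act trivially on the
abelianisation of `F_n`. -/
def palTorelli (n : ℕ) : Subgroup (MulAut (F n)) where
  carrier := {α | α ∈ palAut n ∧
    ∀ g : F n, Abelianization.of (α g) = Abelianization.of g}
  one_mem' := ⟨one_mem _, fun _ => rfl⟩
  mul_mem' := by
    rintro α β ⟨hα, hα'⟩ ⟨hβ, hβ'⟩
    exact ⟨mul_mem hα hβ, fun g => by rw [MulAut.mul_apply, hα', hβ']⟩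
  inv_mem' := by
    rintro α ⟨hα, hα'⟩
    exact ⟨inv_mem hα, fun g => by rw [← hα' (α⁻¹ g), MulAut.apply_inv_self]⟩

/-- `φ ∈ PI_n` is a doubled commutator transvection: there are a `π`-basis
`Y = {α x_l}` (`α ∈ ΠA_n`) and distinct members `y₁ = α x_i`, `y₂ = α x_j`, `y₃ = α x_k` of it
such that `φ` maps `y₁` to `[y₂, y₃]^rev y₁ [y₂, y₃]` and fixes the other members of `Y`. -/
def IsDoubledCommutatorTransvection {n : ℕ} (φ : MulAut (F n)) : Prop :=
  φ ∈ palTorelli n ∧ ∃ α ∈ palAut n, ∃ i j k : Fin n, i ≠ j ∧ i ≠ k ∧ j ≠ k ∧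
    φ (α (FreeGroup.of i)) =
      rev ⁅α (FreeGroup.of j), α (FreeGroup.of k)⁆ * α (FreeGroup.of i) *
        ⁅α (FreeGroup.of j), α (FreeGroup.of k)⁆ ∧
    ∀ l, l ≠ i → φ (α (FreeGroup.of l)) = α (FreeGroup.of l)

/-- The subgroup generated by the doubled commutator transvections. -/
def doubledCommutatorSubgroup (n : ℕ) : Subgroup (MulAut (F n)) :=
  Subgroup.closure {φ | IsDoubledCommutatorTransvection φ}

/-- The endomorphism `x_i ↦ x_j ^ e x_i x_j ^ e`, `x_k ↦ x_k` for `k ≠ i`. -/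
def elemHom {n : ℕ} (i j : Fin n) (e : ℤ) : F n →* F n :=
  FreeGroup.lift fun k =>
    if k = i then FreeGroup.of j ^ e * FreeGroup.of i * FreeGroup.of j ^ e else FreeGroup.of k

theorem elemHom_comp {n : ℕ} {i j : Fin n} (h : i ≠ j) (e : ℤ) :
    (elemHom i j (-e)).comp (elemHom i j e) = MonoidHom.id (F n) := by
  ext k
  by_cases hk : k = i
  · subst hk
    simp [elemHom, h.symm, mul_assoc]
  · simp [elemHom, hk]

/-- The elementary palindromic automorphism `P_ij`: `x_i ↦ x_j x_i x_j`, `x_k ↦ x_k` for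
`k ≠ i`. -/
def P {n : ℕ} (i j : Fin n) (h : i ≠ j) : MulAut (F n) :=
  (elemHom i j 1).toMulEquiv (elemHom i j (-1)) (elemHom_comp h 1)
    (by simpa only [neg_neg] using elemHom_comp h (-1))

/-- The endomorphism `x_i ↦ x_i⁻¹`, `x_k ↦ x_k` for `k ≠ i`. -/
def invHom {n : ℕ} (i : Fin n) : F n →* F n :=
  FreeGroup.lift fun k => if k = i then (FreeGroup.of i)⁻¹ else FreeGroup.of k

theorem invHom_comp {n : ℕ} (i : Fin n) :
    (invHom i).comp (invHom i) = MonoidHom.id (F n) := by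
  ext k
  by_cases hk : k = i
  · subst hk
    simp [invHom]
  · simp [invHom, hk]

/-- The inversion `ι_i`: `x_i ↦ x_i⁻¹`, `x_k ↦ x_k` for `k ≠ i`. -/
def inversion {n : ℕ} (i : Fin n) : MulAut (F n) :=
  (invHom i).toMulEquiv (invHom i) (invHom_comp i) (invHom_comp i)

/-- The pure palindromic automorphism group `PΠA_n`, generated by the elementary palindromic
automorphisms and the inversions. -/
def purePalAut (n : ℕ) : Subgroup (MulAut (F n)) :=
  Subgroup.closure ({φ | ∃ i j, ∃ h : i ≠ j, φ = P i j h} ∪ {φ | ∃ i, φ = inversion i})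

/-- `P_ij` as an element of `PΠA_n`. -/
def pureP {n : ℕ} (i j : Fin n) (h : i ≠ j) : purePalAut n :=
  ⟨P i j h, Subgroup.subset_closure (Or.inl ⟨i, j, h, rfl⟩)⟩

/-- `ι_i` as an element of `PΠA_n`. -/
def pureInversion {n : ℕ} (i : Fin n) : purePalAut n :=
  ⟨inversion i, Subgroup.subset_closure (Or.inr ⟨i, rfl⟩)⟩

/-- `χ₂ = (P_23 P_13⁻¹ P_31 P_32 P_12 P_21⁻¹)²`, where the indices `1, 2, 3` are `i, j, k`. -/
def chi2 {n : ℕ} (i j k : Fin n) (hij : i ≠ j) (hik : i ≠ k) (hjk : j ≠ k) : purePalAut n :=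
  (pureP j k hjk * (pureP i k hik)⁻¹ * pureP k i hik.symm * pureP k j hjk.symm *
    pureP i j hij * (pureP j i hij.symm)⁻¹) ^ 2

/-- The formal generators `S_ij` (`i ≠ j`) and `O_i`. -/
inductive Gen (n : ℕ) : Type
  | S (i j : Fin n) (h : i ≠ j) : Gen n
  | O (i : Fin n) : Gen n

/-- `S_ij` in the free group on the formal generators. -/
def fS {n : ℕ} (i j : Fin n) (h : i ≠ j) : FreeGroup (Gen n) := FreeGroup.of (Gen.S i j h)

/-- `O_i` in the free group on the formal generators. -/
def fO {n : ℕ} (i : Fin n) : FreeGroup (Gen n) := FreeGroup.of (Gen.O i)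

/-- The relators (1)-(9) of the standard presentation of the level 2 congruence subgroup of
`GL(n, ℤ)`, i.e. all of them except the relators
(10) `(S_ij S_ik⁻¹ S_ki S_ji S_jk S_kj⁻¹)²`. Different letters are different indices. -/
inductive Relator (n : ℕ) : FreeGroup (Gen n) → Prop
  | r1 (i : Fin n) : Relator n (fO i ^ 2)
  | r2 (i j : Fin n) (hij : i ≠ j) : Relator n ⁅fO i, fO j⁆
  | r3 (i j : Fin n) (hij : i ≠ j) : Relator n ((fO i * fS i j hij) ^ 2)
  | r4 (i j : Fin n) (hij : i ≠ j) : Relator n ((fO j * fS i j hij) ^ 2)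
  | r5 (i j k : Fin n) (hij : i ≠ j) (hik : i ≠ k) (hjk : j ≠ k) :
      Relator n ⁅fO i, fS j k hjk⁆
  | r6 (i j k : Fin n) (hij : i ≠ j) (hki : k ≠ i) (hkj : k ≠ j) :
      Relator n ⁅fS k i hki, fS k j hkj⁆
  | r7 (i j k l : Fin n) (hij : i ≠ j) (hik : i ≠ k) (hil : i ≠ l) (hjk : j ≠ k) (hjl : j ≠ l)
      (hkl : k ≠ l) : Relator n ⁅fS i j hij, fS k l hkl⁆
  | r8 (i j k : Fin n) (hji : j ≠ i) (hki : k ≠ i) (hjk : j ≠ k) :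
      Relator n ⁅fS j i hji, fS k i hki⁆
  | r9 (i j k : Fin n) (hji : j ≠ i) (hki : k ≠ i) (hkj : k ≠ j) :
      Relator n (⁅fS k j hkj, fS j i hji⁆ * (fS k i hki ^ 2)⁻¹)

/-- The group presented by the generators `S_ij`, `O_i` and the relators (1)-(9). -/
abbrev Q (n : ℕ) : Type := PresentedGroup {r : FreeGroup (Gen n) | Relator n r}

/-- `S_ij` in `Q n`. -/
def qS {n : ℕ} (i j : Fin n) (h : i ≠ j) : Q n := PresentedGroup.of (Gen.S i j h)

/-- `O_i` in `Q n`. -/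
def qO {n : ℕ} (i : Fin n) : Q n := PresentedGroup.of (Gen.O i)

/-- `ξ = (S_32 S_31⁻¹ S_13 S_23 S_21 S_12⁻¹)²` in `Q n`, where the indices `1, 2, 3` are
`i, j, k`. This is a relator of type (10). -/
def xi {n : ℕ} (i j k : Fin n) (hij : i ≠ j) (hik : i ≠ k) (hjk : j ≠ k) : Q n :=
  (qS k j hjk.symm * (qS k i hik.symm)⁻¹ * qS i k hik * qS j k hjk *
    qS j i hij.symm * (qS i j hij)⁻¹) ^ 2

/-- The Coxeter matrix of the free Coxeter group of rank 2: no relation between the two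
generators (the entry `0` stands for `∞`). -/
def freeCoxeterMatrix : CoxeterMatrix (Fin 2) where
  M := fun a b => if a = b then 1 else 0
  isSymm := by
    ext a b
    show (if b = a then 1 else 0) = (if a = b then 1 else 0)
    simp [eq_comm]
  diagonal := by simp
  off_diagonal := by
    intro a b h
    simp [h]

/-- The free Coxeter group `⟨A, B ∣ A² = B² = 1⟩`. -/
abbrev W : Type := freeCoxeterMatrix.Group

/-- The generator `A` of the free Coxeter group. -/
def A : W := freeCoxeterMatrix.simple 0

/-- The generator `B` of the free Coxeter group. -/
def B : W := freeCoxeterMatrix.simple 1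

end PalTorelli

namespace PalTorelli

open scoped commutatorElement

/-! ### The free Coxeter group of rank two acts faithfully on `ℤ` -/

/-! Let F_n act on ℤ² with x_i and x_j as the unit translations and every other x_l as z ↦ -z. Under
this action reversal becomes T ↦ sT⁻¹s, where s is the point reflection at 0
(`exists_affineRep_form`). Hence u y u^rev acts as -1 if y does, and as a translation by a vector
congruent to c mod 2 if y is the translation by c. A palindromic automorphism sends x_m to u
x_{τ(m)}^{±1} u^rev for a permutation τ, so it carries one action of this kind to another through a
matrix congruent to 1 mod 2 (`palAut_exists_intertwines`). Pure automorphisms preserve the pair i,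
j, and this gives a homomorphism to the level two congruence subgroup of GL(2, ℤ).

That subgroup maps onto W. No presentation of it is needed: a signed count of steps in the Euclidean
algorithm with even quotients attaches an integer height to vectors with odd first and even second
entry. An elementary matrix and its inverse change the height in the same way, by m ↦ -m or by m ↦ 1
- m, which is a faithful action of W on ℤ. So each matrix determines exactly one element of W
(`exists_actsAs`, `ActsAs.unique`).

A doubled commutator transvection is conjugate in ΠA_n to a standard one, whose matrix is the
identity or the square of an elementary matrix; it dies in W because A² = B² = 1. But χ₂ goes to
(BA)², the translation by 2, although it is trivial on the abelianisation. For Q_n the generators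
are sent to W directly: modulo squares, the relators (1)-(9) never ask S_ij to commute with S_ji. -/

/-- The action of `W` on `ℤ` for which `A` is `m ↦ -m` and `B` is `m ↦ 1 - m`. -/
def dihedralAction : W →* Equiv.Perm ℤ :=
  freeCoxeterMatrix.toCoxeterSystem.lift
    ⟨fun a => if a = 0 then Equiv.neg ℤ else Equiv.subLeft 1, by
      intro a b
      by_cases h : a = b
      · subst h
        have h1 : freeCoxeterMatrix a a = 1 := freeCoxeterMatrix.diagonal a
        rw [h1, pow_one]
        ext m
        by_cases ha : a = 0 <;> simp [ha]
      · have h0 : freeCoxeterMatrix a b = 0 := if_neg h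
        rw [h0, pow_zero]⟩

theorem dihedralAction_A (m : ℤ) : dihedralAction A m = -m := by
  have h : dihedralAction A = Equiv.neg ℤ :=
    (freeCoxeterMatrix.toCoxeterSystem.lift_apply_simple _ 0).trans (if_pos rfl)
  rw [h]; rfl

theorem dihedralAction_B (m : ℤ) : dihedralAction B m = 1 - m := by
  have h : dihedralAction B = Equiv.subLeft 1 :=
    (freeCoxeterMatrix.toCoxeterSystem.lift_apply_simple _ 1).trans (if_neg (by decide))
  rw [h]; rfl

theorem A_mul_A : A * A = 1 := freeCoxeterMatrix.toCoxeterSystem.simple_mul_simple_self 0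

theorem B_mul_B : B * B = 1 := freeCoxeterMatrix.toCoxeterSystem.simple_mul_simple_self 1

theorem A_inv : A⁻¹ = A := inv_eq_of_mul_eq_one_left A_mul_A

/-- The rotations (BA)^m together with the reflections A(BA)^m are closed under left multiplication
by A and by B. -/
theorem exists_zpow_form (w : W) : ∃ m : ℤ, w = (B * A) ^ m ∨ w = A * (B * A) ^ m := by
  induction w using freeCoxeterMatrix.toCoxeterSystem.simple_induction_left with
  | one => exact ⟨0, Or.inl (by simp)⟩
  | mul_simple_left w a ih =>
    obtain ⟨m, hm⟩ := ih
    fin_cases a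
    · change ∃ l : ℤ, A * w = _ ∨ A * w = _
      rcases hm with rfl | rfl
      · exact ⟨m, Or.inr rfl⟩
      · exact ⟨m, Or.inl (by rw [← mul_assoc, A_mul_A, one_mul])⟩
    · change ∃ l : ℤ, B * w = _ ∨ B * w = _
      rcases hm with rfl | rfl
      · refine ⟨m - 1, Or.inr ?_⟩
        have h := zpow_one_add (B * A) (m - 1)
        rw [add_sub_cancel] at h
        rw [h, mul_assoc B, ← mul_assoc, B_mul_B, one_mul]
      · refine ⟨1 + m, Or.inl ?_⟩
        rw [← mul_assoc, zpow_one_add]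

theorem dihedralAction_zpow (m l : ℤ) : dihedralAction ((B * A) ^ m) l = l + m := by
  have h (x : ℤ) : dihedralAction (B * A) x = x + 1 := by
    rw [map_mul, Equiv.Perm.mul_apply, dihedralAction_A, dihedralAction_B]
    ring
  rw [map_zpow]
  induction m generalizing l with
  | zero => simp
  | succ m ih => rw [zpow_add_one, Equiv.Perm.mul_apply, ih, h]; ring
  | pred m ih =>
    rw [zpow_sub_one, Equiv.Perm.mul_apply, ih, (Equiv.Perm.inv_eq_iff_eq (y := l - 1)).2]
    · ring
    · rw [h]; ring

/-- A rotation (BA)^m fixes 0 only if m = 0, and a reflection A(BA)^m fixing 0 is m ↦ -m, which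
moves 1. So W acts faithfully, already on the two points 0 and 1. -/
theorem eq_one_of_dihedralAction {w : W} (h0 : dihedralAction w 0 = 0)
    (h1 : dihedralAction w 1 = 1) : w = 1 := by
  obtain ⟨m, rfl | rfl⟩ := exists_zpow_form w
  · rw [dihedralAction_zpow] at h0
    have : m = 0 := by omega
    simp [this]
  · rw [map_mul, Equiv.Perm.mul_apply, dihedralAction_zpow, dihedralAction_A] at h0 h1
    omega

theorem eq_of_dihedralAction {w w' : W} (h0 : dihedralAction w 0 = dihedralAction w' 0)
    (h1 : dihedralAction w 1 = dihedralAction w' 1) : w = w' := by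
  rw [← inv_mul_eq_one]
  apply eq_one_of_dihedralAction <;>
    rw [map_mul, map_inv, Equiv.Perm.mul_apply, Equiv.Perm.inv_eq_iff_eq] <;> simp [h0, h1]

theorem sq_B_mul_A_ne_one : (B * A) ^ 2 ≠ 1 := by
  intro h
  have h2 := dihedralAction_zpow 2 0
  rw [zpow_ofNat, h] at h2
  simp at h2

theorem surjective_of_A_of_B {G : Type*} [Group G] (f : G →* W) {a b : G} (ha : f a = A)
    (hb : f b = B) : Function.Surjective f := by
  rw [← MonoidHom.range_eq_top, eq_top_iff,
    ← freeCoxeterMatrix.toCoxeterSystem.subgroup_closure_range_simple, Subgroup.closure_le]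
  rintro _ ⟨c, rfl⟩
  fin_cases c
  · exact ⟨a, ha⟩
  · exact ⟨b, hb⟩

/-! ### The level two congruence subgroup of `GL(2, ℤ)` maps onto `W` -/

/-- The signed number of steps of the Euclidean algorithm with even quotients. -/
def evenEuclid (a c : ℕ) : ℤ :=
  if c = 0 then 0
  else if c < a then -evenEuclid ((a : ℤ) - 2 * c).natAbs c
  else if 0 < a ∧ a < c then 1 - evenEuclid a ((c : ℤ) - 2 * a).natAbs
  else 0
termination_by a + c
decreasing_by all_goals omega

theorem evenEuclid_add_left (a c : ℕ) : evenEuclid (a + 2 * c) c = -evenEuclid a c := by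
  rw [evenEuclid]
  by_cases hc : c = 0
  · subst hc
    rw [evenEuclid.eq_def (a + 0)]; simp [evenEuclid.eq_def a 0]
  · rw [if_neg hc, if_pos (by omega)]
    congr 2; omega

/-- For c < a this is a step of the algorithm. For a < c the new entry 2c - a exceeds c, and the
step applied to it returns a; since negation is an involution, the formula is the same. -/
theorem evenEuclid_sub_left (a c : ℕ) (h : a ≠ c) :
    evenEuclid ((a : ℤ) - 2 * c).natAbs c = -evenEuclid a c := by
  rcases lt_or_gt_of_ne h with h | h
  · have h1 := evenEuclid_add_left ((a : ℤ) - 2 * c).natAbs c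
    rw [evenEuclid, if_neg (by omega), if_pos (by omega)] at h1
    have h2 : (((((a : ℤ) - 2 * c).natAbs + 2 * c : ℕ) : ℤ) - 2 * c).natAbs
      = ((a : ℤ) - 2 * c).natAbs := by omega
    have h3 : (((((a : ℤ) - 2 * c).natAbs : ℕ) : ℤ) - 2 * c).natAbs = a := by omega
    rw [evenEuclid, if_neg (by omega), if_pos (by omega), h3]
  · rw [evenEuclid.eq_def a c]
    by_cases hc : c = 0
    · subst hc; rw [evenEuclid]; simp
    · rw [if_neg hc, if_pos h, neg_neg]

theorem evenEuclid_add_right (a c : ℕ) (ha : 0 < a) :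
    evenEuclid a (c + 2 * a) = 1 - evenEuclid a c := by
  rw [evenEuclid, if_neg (by omega), if_neg (by omega), if_pos (by omega)]
  congr 2; omega

/-- Here a = 0 and a = c must be excluded: there `evenEuclid` takes its default value 0, which is
not of the form 1 - 0. -/
theorem evenEuclid_sub_right (a c : ℕ) (ha : 0 < a) (h : a ≠ c) :
    evenEuclid a ((c : ℤ) - 2 * a).natAbs = 1 - evenEuclid a c := by
  rcases lt_or_gt_of_ne h with h | h
  · rw [evenEuclid.eq_def a c, if_neg (by omega), if_neg (by omega), if_pos (by omega)]
    ring
  · have h3 : (((((c : ℤ) - 2 * a).natAbs : ℕ) : ℤ) - 2 * a).natAbs = c := by omega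
    rw [evenEuclid, if_neg (by omega), if_neg (by omega), if_pos (by omega), h3]

/-- `evenEuclid` as a function on `ℤ × ℤ`. -/
def evenEuclidHeight (z : ℤ × ℤ) : ℤ := evenEuclid z.1.natAbs z.2.natAbs

/-- Depending on signs, the shear either adds 2|c| to |a| or replaces |a| by ||a| - 2|c||, and both
negate the height. Thus a shear and its inverse act alike, as an involution should. Parity rules out
|a| = |c|. -/
theorem evenEuclidHeight_shear_left {a c : ℤ} (ha : Odd a) (hc : Even c) {e : ℤ}
    (he : e = 1 ∨ e = -1) :
    evenEuclidHeight (a + 2 * e * c, c) = -evenEuclidHeight (a, c) := by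
  have h : (a + 2 * e * c).natAbs = a.natAbs + 2 * c.natAbs ∨
      (a + 2 * e * c).natAbs = ((a.natAbs : ℤ) - 2 * c.natAbs).natAbs := by
    rcases he with rfl | rfl <;> omega
  have hne : a.natAbs ≠ c.natAbs := by
    obtain ⟨x, rfl⟩ := ha; obtain ⟨y, rfl⟩ := hc; omega
  unfold evenEuclidHeight
  rcases h with h | h <;> rw [h]
  · exact evenEuclid_add_left _ _
  · exact evenEuclid_sub_left _ _ hne

theorem evenEuclidHeight_shear_right {a c : ℤ} (ha : Odd a) (hc : Even c) {e : ℤ}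
    (he : e = 1 ∨ e = -1) :
    evenEuclidHeight (a, c + 2 * e * a) = 1 - evenEuclidHeight (a, c) := by
  have h : (c + 2 * e * a).natAbs = c.natAbs + 2 * a.natAbs ∨
      (c + 2 * e * a).natAbs = ((c.natAbs : ℤ) - 2 * a.natAbs).natAbs := by
    rcases he with rfl | rfl <;> omega
  have hne : a.natAbs ≠ c.natAbs ∧ 0 < a.natAbs := by
    obtain ⟨x, rfl⟩ := ha; obtain ⟨y, rfl⟩ := hc; omega
  unfold evenEuclidHeight
  rcases h with h | h <;> rw [h]
  · exact evenEuclid_add_right _ _ hne.2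
  · exact evenEuclid_sub_right _ _ hne.2 hne.1

/-- The level two congruence subgroup of `GL(2, ℤ)`. -/
def levelTwo : Subgroup ((ℤ × ℤ) ≃ₗ[ℤ] (ℤ × ℤ)) where
  carrier := {M | ∀ z, ∃ y, M z = z + (2 : ℤ) • y}
  one_mem' := fun z => ⟨0, by simp⟩
  mul_mem' := by
    intro M N hM hN z
    obtain ⟨y, hy⟩ := hN z
    obtain ⟨x, hx⟩ := hM (N z)
    exact ⟨y + x, by rw [LinearEquiv.mul_apply, hx, hy, smul_add, add_assoc]⟩
  inv_mem' := by
    intro M hM z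
    obtain ⟨y, hy⟩ := hM (M⁻¹ z)
    have h : M (M⁻¹ z) = z := M.apply_symm_apply z
    rw [h] at hy
    exact ⟨-y, by rw [smul_neg, ← sub_eq_add_neg, eq_sub_iff_add_eq]; exact hy.symm⟩

/-- `w` describes the effect of `M` on `evenEuclidHeight`. -/
def ActsAs (M : (ℤ × ℤ) ≃ₗ[ℤ] (ℤ × ℤ)) (w : W) : Prop :=
  ∀ z : ℤ × ℤ, Odd z.1 → Even z.2 →
    evenEuclidHeight (M z) = dihedralAction w (evenEuclidHeight z)

theorem levelTwo_parity {M : (ℤ × ℤ) ≃ₗ[ℤ] (ℤ × ℤ)} (hM : M ∈ levelTwo) {z : ℤ × ℤ}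
    (h1 : Odd z.1) (h2 : Even z.2) : Odd (M z).1 ∧ Even (M z).2 := by
  obtain ⟨y, hy⟩ := hM z
  rw [hy]
  constructor
  · simpa [Int.odd_add] using h1
  · simpa [Int.even_add] using h2

theorem ActsAs.mul {M N : (ℤ × ℤ) ≃ₗ[ℤ] (ℤ × ℤ)} {w v : W} (hM : ActsAs M w)
    (hN : ActsAs N v) (hN' : N ∈ levelTwo) : ActsAs (M * N) (w * v) := by
  intro z h1 h2
  obtain ⟨h3, h4⟩ := levelTwo_parity hN' h1 h2
  rw [LinearEquiv.mul_apply, hM _ h3 h4, hN _ h1 h2, map_mul, Equiv.Perm.mul_apply]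

/-- The vectors (1, 0) and (1, 2) have heights 0 and 1, the two points that determine an element of
W. Uniqueness makes the choice of w multiplicative. -/
theorem ActsAs.unique {M : (ℤ × ℤ) ≃ₗ[ℤ] (ℤ × ℤ)} {w v : W} (h : ActsAs M w)
    (h' : ActsAs M v) : w = v := by
  have e0 : evenEuclidHeight (1, 0) = 0 := by
    unfold evenEuclidHeight; rw [evenEuclid]; simp
  have e1 : evenEuclidHeight (1, 2) = 1 := by
    have := evenEuclidHeight_shear_right (a := 1) (c := 0) (by decide) (by decide) (Or.inl rfl)
    simpa [e0] using this
  apply eq_of_dihedralAction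
  · rw [← e0, ← h _ (by decide) (by decide), ← h' _ (by decide) (by decide)]
  · rw [← e1, ← h _ (by decide) (by decide), ← h' _ (by decide) (by decide)]

/-- `(a, c) ↦ (a + 2 m c, c)`. -/
def shearLeft (m : ℤ) : (ℤ × ℤ) ≃ₗ[ℤ] (ℤ × ℤ) where
  toFun z := (z.1 + 2 * m * z.2, z.2)
  invFun z := (z.1 - 2 * m * z.2, z.2)
  left_inv z := by ext <;> simp
  right_inv z := by ext <;> simp
  map_add' y z := by ext <;> simp; ring
  map_smul' r z := by ext <;> simp; ring

/-- `(a, c) ↦ (a, c + 2 m a)`. -/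
def shearRight (m : ℤ) : (ℤ × ℤ) ≃ₗ[ℤ] (ℤ × ℤ) where
  toFun z := (z.1, z.2 + 2 * m * z.1)
  invFun z := (z.1, z.2 - 2 * m * z.1)
  left_inv z := by ext <;> simp
  right_inv z := by ext <;> simp
  map_add' y z := by ext <;> simp; ring
  map_smul' r z := by ext <;> simp; ring

theorem shearLeft_mem (m : ℤ) : shearLeft m ∈ levelTwo := fun z =>
  ⟨(m * z.2, 0), by ext <;> simp [shearLeft, mul_assoc]⟩

theorem shearRight_mem (m : ℤ) : shearRight m ∈ levelTwo := fun z =>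
  ⟨(0, m * z.1), by ext <;> simp [shearRight, mul_assoc]⟩

theorem actsAs_shearLeft {e : ℤ} (he : e = 1 ∨ e = -1) : ActsAs (shearLeft e) A :=
  fun z h1 h2 => by
    rw [dihedralAction_A]
    exact evenEuclidHeight_shear_left h1 h2 he

theorem actsAs_shearRight {e : ℤ} (he : e = 1 ∨ e = -1) : ActsAs (shearRight e) B :=
  fun z h1 h2 => by
    rw [dihedralAction_B]
    exact evenEuclidHeight_shear_right h1 h2 he

theorem shearLeft_add (m l : ℤ) : shearLeft (m + l) = shearLeft m * shearLeft l := by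
  apply LinearEquiv.ext
  intro z
  rw [LinearEquiv.mul_apply]
  ext <;> simp [shearLeft]; ring

theorem shearRight_add (m l : ℤ) : shearRight (m + l) = shearRight m * shearRight l := by
  apply LinearEquiv.ext
  intro z
  rw [LinearEquiv.mul_apply]
  ext <;> simp [shearRight]; ring

/-! ### Every matrix of level two acts on heights through W -/

theorem actsAs_of_natAbs_eq {M : (ℤ × ℤ) ≃ₗ[ℤ] (ℤ × ℤ)}
    (h : ∀ z, (M z).1.natAbs = z.1.natAbs ∧ (M z).2.natAbs = z.2.natAbs) : ActsAs M 1 :=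
  fun z _ _ => by simp [evenEuclidHeight, h z]

theorem exists_actsAs_shearLeft (m : ℤ) : ∃ w, ActsAs (shearLeft m) w := by
  induction m with
  | zero => exact ⟨1, actsAs_of_natAbs_eq fun z => by simp [shearLeft]⟩
  | succ m ih =>
    obtain ⟨w, hw⟩ := ih
    rw [shearLeft_add]
    exact ⟨_, hw.mul (actsAs_shearLeft (Or.inl rfl)) (shearLeft_mem _)⟩
  | pred m ih =>
    obtain ⟨w, hw⟩ := ih
    rw [sub_eq_add_neg, shearLeft_add]
    exact ⟨_, hw.mul (actsAs_shearLeft (Or.inr rfl)) (shearLeft_mem _)⟩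

theorem isUnit_of_apply_eq_smul (M : (ℤ × ℤ) ≃ₗ[ℤ] (ℤ × ℤ)) {p : ℤ} {y z : ℤ × ℤ}
    (h : M z = p • y) (hz : z = (1, 0) ∨ z = (0, 1)) : IsUnit p := by
  have h1 : z = p • M.symm y := by rw [← map_smul, ← h, M.symm_apply_apply]
  rcases hz with rfl | rfl
  · exact IsUnit.of_mul_eq_one _ (congrArg Prod.fst h1).symm
  · exact IsUnit.of_mul_eq_one _ (congrArg Prod.snd h1).symm

theorem linearEquiv_apply (M : (ℤ × ℤ) ≃ₗ[ℤ] (ℤ × ℤ)) (z : ℤ × ℤ) :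
    M z = z.1 • M (1, 0) + z.2 • M (0, 1) := by
  rw [← map_smul, ← map_smul, ← map_add]
  simp

theorem exists_actsAs_of_snd_eq_zero {M : (ℤ × ℤ) ≃ₗ[ℤ] (ℤ × ℤ)} (hM : M ∈ levelTwo)
    (h0 : (M (1, 0)).2 = 0) : ∃ w, ActsAs M w := by
  have hp : IsUnit (M (1, 0)).1 :=
    isUnit_of_apply_eq_smul M (y := (1, 0)) (by ext <;> simp [h0]) (Or.inl rfl)
  obtain ⟨t, ht⟩ := M.surjective (0, 1)
  have ht2 := ht
  rw [linearEquiv_apply] at ht2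
  -- The matrix is upper triangular, so the second row of M t = (0, 1) shows that the lower diagonal
  -- entry is a unit.
  have hs : t.2 * (M (0, 1)).2 = 1 := by simpa [h0] using congrArg Prod.snd ht2
  have hs' : IsUnit (M (0, 1)).2 := IsUnit.of_mul_eq_one _ ((mul_comm _ _).trans hs)
  obtain ⟨y, hy⟩ := hM (0, 1)
  have hq : (M (0, 1)).1 = 2 * y.1 := by rw [hy]; simp
  -- M is a shear times a diagonal sign matrix. With s = ±1 the lower diagonal entry, the upper
  -- right entry 2 y.1 must equal 2 m s, so m = y.1 * s.
  obtain ⟨w, hw⟩ := exists_actsAs_shearLeft (y.1 * (M (0, 1)).2)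
  let p := (M (1, 0)).1
  let s := (M (0, 1)).2
  have hpp : p * p = 1 := Int.isUnit_mul_self hp
  have hss : s * s = 1 := Int.isUnit_mul_self hs'
  let D : (ℤ × ℤ) ≃ₗ[ℤ] (ℤ × ℤ) :=
    { toFun := fun z => (p * z.1, s * z.2)
      invFun := fun z => (p * z.1, s * z.2)
      left_inv := fun z => by ext <;> simp [← mul_assoc, hpp, hss]
      right_inv := fun z => by ext <;> simp [← mul_assoc, hpp, hss]
      map_add' := fun y z => by ext <;> simp [mul_add]
      map_smul' := fun r z => by ext <;> simp [mul_left_comm] }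
  have hMD : M = shearLeft (y.1 * s) * D := by
    apply LinearEquiv.ext
    intro z
    rw [LinearEquiv.mul_apply, linearEquiv_apply]
    ext
    · simp only [shearLeft, D, LinearEquiv.coe_mk, LinearMap.coe_mk, AddHom.coe_mk,
        Prod.fst_add, Prod.smul_fst, smul_eq_mul, hq]
      linear_combination (-2 * y.1 * z.2) * hss
    · simp [shearLeft, D, h0, s, mul_comm]
  have hD : D ∈ levelTwo := by
    have := mul_mem (inv_mem (shearLeft_mem (y.1 * s))) hM
    rwa [hMD, inv_mul_cancel_left] at this
  rw [hMD]
  refine ⟨w * 1, hw.mul (actsAs_of_natAbs_eq fun z => ?_) hD⟩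
  simp [D, Int.natAbs_mul, p, s, Int.isUnit_iff_natAbs_eq.1 hp, Int.isUnit_iff_natAbs_eq.1 hs']

/-- Descent on the size of the first column (a, c) by the Euclidean algorithm with even quotients.
As a is odd and c is even, |a| ≠ |c|, and for c ≠ 0 adding or subtracting twice the smaller entry
shortens the larger one. -/
theorem exists_actsAs {M : (ℤ × ℤ) ≃ₗ[ℤ] (ℤ × ℤ)} (hM : M ∈ levelTwo) : ∃ w, ActsAs M w := by
  induction hN : (M (1, 0)).1.natAbs + (M (1, 0)).2.natAbs using Nat.strong_induction_on
    generalizing M with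
  | _ N ih =>
  by_cases h0 : (M (1, 0)).2 = 0
  · exact exists_actsAs_of_snd_eq_zero hM h0
  obtain ⟨⟨x, hx⟩, ⟨y, hy⟩⟩ := levelTwo_parity hM (z := (1, 0)) (by decide) (by decide)
  have key : ∀ (e : ℤ), e = 1 ∨ e = -1 →
      ((M (1, 0)).1 + 2 * e * (M (1, 0)).2).natAbs < (M (1, 0)).1.natAbs ∨
      ((M (1, 0)).2 + 2 * e * (M (1, 0)).1).natAbs < (M (1, 0)).2.natAbs →
      ∃ w, ActsAs M w := by
    rintro e he (h | h)
    · obtain ⟨w, hw⟩ := ih _ (by simp only [shearLeft, LinearEquiv.mul_apply,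
        LinearEquiv.coe_mk, LinearMap.coe_mk, AddHom.coe_mk]; omega)
        (mul_mem (shearLeft_mem e) hM) rfl
      have h1 : M = shearLeft (-e) * (shearLeft e * M) := by
        rw [← mul_assoc, ← shearLeft_add]
        apply LinearEquiv.ext
        intro z
        ext <;> simp [shearLeft]
      rw [h1]
      exact ⟨_, (actsAs_shearLeft (by omega)).mul hw (mul_mem (shearLeft_mem e) hM)⟩
    · obtain ⟨w, hw⟩ := ih _ (by simp only [shearRight, LinearEquiv.mul_apply,
        LinearEquiv.coe_mk, LinearMap.coe_mk, AddHom.coe_mk]; omega)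
        (mul_mem (shearRight_mem e) hM) rfl
      have h1 : M = shearRight (-e) * (shearRight e * M) := by
        rw [← mul_assoc, ← shearRight_add]
        apply LinearEquiv.ext
        intro z
        ext <;> simp [shearRight]
      rw [h1]
      exact ⟨_, (actsAs_shearRight (by omega)).mul hw (mul_mem (shearRight_mem e) hM)⟩
  have h1 := key 1 (Or.inl rfl)
  have h2 := key (-1) (Or.inr rfl)
  by_cases h3 : ((M (1, 0)).1 + 2 * 1 * (M (1, 0)).2).natAbs < (M (1, 0)).1.natAbs ∨
      ((M (1, 0)).2 + 2 * 1 * (M (1, 0)).1).natAbs < (M (1, 0)).2.natAbs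
  · exact h1 h3
  · exact h2 (by omega)

/-- The homomorphism from the level two congruence subgroup of `GL(2, ℤ)` to `W` that maps the
elementary matrices to `A` and `B` and the diagonal matrices to `1`. -/
noncomputable def levelTwoToW : levelTwo →* W :=
  MonoidHom.mk' (fun M => (exists_actsAs M.2).choose) fun M N =>
    (exists_actsAs (M * N).2).choose_spec.unique
      ((exists_actsAs M.2).choose_spec.mul (exists_actsAs N.2).choose_spec N.2)

theorem levelTwoToW_eq {M : levelTwo} {w : W} (h : ActsAs M w) : levelTwoToW M = w :=
  (exists_actsAs M.2).choose_spec.unique h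

/-! ### The affine representations of the free group -/

/-- The action of `F_n` on `ℤ × ℤ` in which `x_i` and `x_j` are the unit translations and the other
`x_l` are the point reflection `z ↦ -z`. -/
def affineRep {n : ℕ} (i j : Fin n) : F n →* Equiv.Perm (ℤ × ℤ) :=
  FreeGroup.lift fun l =>
    if l = i then Equiv.addRight (1, 0) else if l = j then Equiv.addRight (0, 1) else Equiv.neg _

section
variable {n : ℕ} {i j : Fin n}

theorem affineRep_left (z : ℤ × ℤ) : affineRep i j (FreeGroup.of i) z = z + (1, 0) := by
  simp [affineRep]

theorem affineRep_right (hij : i ≠ j) (z : ℤ × ℤ) :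
    affineRep i j (FreeGroup.of j) z = z + (0, 1) := by
  simp [affineRep, hij.symm]

theorem affineRep_other {l : Fin n} (hi : l ≠ i) (hj : l ≠ j) (z : ℤ × ℤ) :
    affineRep i j (FreeGroup.of l) z = -z := by
  simp [affineRep, hi, hj]

theorem affineRep_left_inv (z : ℤ × ℤ) :
    affineRep i j (FreeGroup.of i)⁻¹ z = z - (1, 0) := by
  rw [map_inv, Equiv.Perm.inv_eq_iff_eq, affineRep_left, sub_add_cancel]

theorem affineRep_right_inv (hij : i ≠ j) (z : ℤ × ℤ) :
    affineRep i j (FreeGroup.of j)⁻¹ z = z - (0, 1) := by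
  rw [map_inv, Equiv.Perm.inv_eq_iff_eq, affineRep_right hij, sub_add_cancel]

theorem affineRep_other_inv {l : Fin n} (hi : l ≠ i) (hj : l ≠ j) (z : ℤ × ℤ) :
    affineRep i j (FreeGroup.of l)⁻¹ z = -z := by
  rw [map_inv, Equiv.Perm.inv_eq_iff_eq, affineRep_other hi hj, neg_neg]

theorem affineRep_mul (g h : F n) (z : ℤ × ℤ) :
    affineRep i j (g * h) z = affineRep i j g (affineRep i j h z) := by
  rw [map_mul, Equiv.Perm.mul_apply]

/-- The inverse of T : z ↦ v + ez is z ↦ e(z - v), and conjugating it by z ↦ -z gives z ↦ e(z + v).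
This anti-automorphism fixes translations and the reflection at 0, hence agrees with reversal on the
basis and so everywhere. -/
theorem exists_affineRep_form (hij : i ≠ j) (u : F n) : ∃ (e : ℤ) (v : ℤ × ℤ), e * e = 1 ∧
    (∀ z, affineRep i j u z = v + e • z) ∧ ∀ z, affineRep i j (rev u) z = e • (z + v) := by
  induction u using FreeGroup.induction_on with
  | C1 => exact ⟨1, 0, by norm_num, by simp, by simp [rev_one]⟩
  | of l =>
    rw [rev_of]
    by_cases hi : l = i
    · subst hi
      exact ⟨1, (1, 0), by norm_num, fun z => by rw [affineRep_left, one_smul, add_comm],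
        fun z => by rw [affineRep_left, one_smul]⟩
    by_cases hj : l = j
    · subst hj
      exact ⟨1, (0, 1), by norm_num, fun z => by rw [affineRep_right hij, one_smul, add_comm],
        fun z => by rw [affineRep_right hij, one_smul]⟩
    exact ⟨-1, 0, by norm_num, fun z => by rw [affineRep_other hi hj]; simp,
      fun z => by rw [affineRep_other hi hj]; simp⟩
  | inv_of l _ =>
    rw [rev_inv, rev_of]
    by_cases hi : l = i
    · subst hi
      exact ⟨1, -(1, 0), by norm_num,
        fun z => by rw [affineRep_left_inv, one_smul, sub_eq_neg_add],
        fun z => by rw [affineRep_left_inv, one_smul, sub_eq_add_neg]⟩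
    by_cases hj : l = j
    · subst hj
      exact ⟨1, -(0, 1), by norm_num,
        fun z => by rw [affineRep_right_inv hij, one_smul, sub_eq_neg_add],
        fun z => by rw [affineRep_right_inv hij, one_smul, sub_eq_add_neg]⟩
    exact ⟨-1, 0, by norm_num, fun z => by rw [affineRep_other_inv hi hj]; simp,
      fun z => by rw [affineRep_other_inv hi hj]; simp⟩
  | mul g h hg hh =>
    obtain ⟨e, v, he, h1, h2⟩ := hg
    obtain ⟨e', v', he', h3, h4⟩ := hh
    refine ⟨e * e', v + e • v', by linear_combination e' * e' * he + he', fun z => ?_,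
      fun z => ?_⟩
    · rw [affineRep_mul, h3, h1, smul_add, smul_smul, add_assoc]
    · rw [rev_mul, affineRep_mul, h2, h4]
      ext <;> simp
      · linear_combination (-e' * v'.1) * he
      · linear_combination (-e' * v'.2) * he

/-- `M` intertwines the action `affineRep i' j'` and the twist by `α` of the action
`affineRep i j`. -/
def Intertwines (i j i' j' : Fin n) (α : MulAut (F n)) (M : (ℤ × ℤ) ≃ₗ[ℤ] (ℤ × ℤ)) : Prop :=
  ∀ g z, affineRep i j (α g) (M z) = M (affineRep i' j' g z)

theorem intertwines_of_forall_of {i' j' : Fin n} {α : MulAut (F n)}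
    {M : (ℤ × ℤ) →ₗ[ℤ] (ℤ × ℤ)}
    (h : ∀ l z, affineRep i j (α (FreeGroup.of l)) (M z)
      = M (affineRep i' j' (FreeGroup.of l) z)) (g : F n) (z : ℤ × ℤ) :
    affineRep i j (α g) (M z) = M (affineRep i' j' g z) := by
  induction g using FreeGroup.induction_on generalizing z with
  | C1 => simp
  | of l => exact h l z
  | inv_of l _ =>
    rw [map_inv, map_inv, Equiv.Perm.inv_eq_iff_eq, h, ← affineRep_mul]
    simp
  | mul g g' hg hg' => rw [map_mul, affineRep_mul, hg', hg, affineRep_mul]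

theorem Intertwines.mul {i' j' i'' j'' : Fin n} {α β : MulAut (F n)}
    {M N : (ℤ × ℤ) ≃ₗ[ℤ] (ℤ × ℤ)} (hM : Intertwines i j i' j' α M)
    (hN : Intertwines i' j' i'' j'' β N) : Intertwines i j i'' j'' (α * β) (M * N) := by
  intro g z
  rw [MulAut.mul_apply, LinearEquiv.mul_apply, hM, hN, LinearEquiv.mul_apply]

theorem Intertwines.inv {i' j' : Fin n} {α : MulAut (F n)} {M : (ℤ × ℤ) ≃ₗ[ℤ] (ℤ × ℤ)}
    (hM : Intertwines i j i' j' α M) : Intertwines i' j' i j α⁻¹ M⁻¹ := by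
  intro g z
  have h := hM (α⁻¹ g) (M⁻¹ z)
  have hz : M (M⁻¹ z) = z := M.apply_symm_apply z
  rw [MulAut.apply_inv_self, hz] at h
  rw [h]
  exact (M.symm_apply_apply _).symm

theorem intertwines_one : Intertwines i j i j 1 1 := fun _ _ => rfl

/-- Since x_{i'} and x_{j'} move 0 to the two unit vectors, a linear intertwiner is determined by
its value 0 at the origin. -/
theorem eq_of_intertwines {i' j' : Fin n} (hij' : i' ≠ j') {α : MulAut (F n)}
    {M N : (ℤ × ℤ) →ₗ[ℤ] (ℤ × ℤ)}
    (hM : ∀ g z, affineRep i j (α g) (M z) = M (affineRep i' j' g z))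
    (hN : ∀ g z, affineRep i j (α g) (N z) = N (affineRep i' j' g z)) : M = N := by
  have h (g : F n) : M (affineRep i' j' g 0) = N (affineRep i' j' g 0) := by
    rw [← hM, ← hN, map_zero M, map_zero N]
  have h1 := h (FreeGroup.of i')
  have h2 := h (FreeGroup.of j')
  rw [affineRep_left, zero_add] at h1
  rw [affineRep_right hij', zero_add] at h2
  apply LinearMap.ext
  intro z
  have hz : z = z.1 • ((1, 0) : ℤ × ℤ) + z.2 • ((0, 1) : ℤ × ℤ) := by simp
  rw [hz, map_add, map_add, map_smul, map_smul, map_smul, map_smul, h1, h2]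

theorem Intertwines.unique (hij : i ≠ j) {α : MulAut (F n)} {M N : (ℤ × ℤ) ≃ₗ[ℤ] (ℤ × ℤ)}
    (hM : Intertwines i j i j α M) (hN : Intertwines i j i j α N) : M = N :=
  LinearEquiv.toLinearMap_injective (eq_of_intertwines hij hM hN)

/-! ### Palindromic automorphisms permute the basis up to conjugation -/

theorem map_rev {G : Type*} [CommGroup G] (f : F n →* G) (u : F n) : f (rev u) = f u := by
  induction u using FreeGroup.induction_on with
  | C1 => rw [rev_one]
  | of l => rw [rev_of]
  | inv_of l _ => rw [rev_inv, rev_of]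
  | mul g h hg hh => rw [rev_mul, map_mul, map_mul, hg, hh, mul_comm]

/-- Peeling off equal outer letters leaves the middle letter, or nothing if the length is even. -/
theorem IsPalindrome.exists_eq {g : F n} (hg : IsPalindrome g) : ∃ u y : F n,
    g = u * y * rev u ∧ (y = 1 ∨ ∃ l, y = FreeGroup.of l ∨ y = (FreeGroup.of l)⁻¹) := by
  obtain ⟨L, hL, rfl⟩ := hg
  induction hL with
  | nil => exact ⟨1, 1, by rw [rev_one]; rfl, Or.inl rfl⟩
  | singleton x =>
    refine ⟨1, FreeGroup.mk [x], by simp [rev_one], Or.inr ⟨x.1, ?_⟩⟩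
    obtain ⟨l, b⟩ := x
    cases b
    · exact Or.inr (by simp [FreeGroup.of, FreeGroup.inv_mk, FreeGroup.invRev])
    · exact Or.inl rfl
  | @cons_concat x L hL ih =>
    obtain ⟨u, y, h, hy⟩ := ih
    refine ⟨FreeGroup.mk [x] * u, y, ?_, hy⟩
    have h2 : (FreeGroup.mk (x :: (L ++ [x])) : F n)
        = FreeGroup.mk [x] * FreeGroup.mk L * FreeGroup.mk [x] := by simp
    rw [h2, h, rev_mul, rev_mk]
    simp only [List.reverse_singleton, mul_assoc]

theorem map_conj_rev (f : F n →* ℤˣ) (u y : F n) : f (u * y * rev u) = f y := by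
  rw [map_mul, map_mul, map_rev, mul_right_comm, Int.units_mul_self, one_mul]

theorem map_conj_rev_gen (f : F n →* ℤˣ) (u : F n) {y : F n} {l : Fin n}
    (hy : y = FreeGroup.of l ∨ y = (FreeGroup.of l)⁻¹) :
    f (u * y * rev u) = f (FreeGroup.of l) := by
  rw [map_conj_rev]
  rcases hy with rfl | rfl
  · rfl
  · rw [map_inv, Int.units_inv_eq_self]

/-- The number of letters `x_l` modulo two. -/
def letterParity (l : Fin n) : F n →* ℤˣ := FreeGroup.lift fun m => if m = l then -1 else 1

theorem palAut_exists_perm {α : MulAut (F n)} (hα : α ∈ palAut n) : ∃ τ : Equiv.Perm (Fin n),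
    ∀ m, ∃ u y : F n, α (FreeGroup.of m) = u * y * rev u ∧
      (y = FreeGroup.of (τ m) ∨ y = (FreeGroup.of (τ m))⁻¹) := by
  have h (m : Fin n) : ∃ (l : Fin n) (u y : F n), α (FreeGroup.of m) = u * y * rev u ∧
      (y = FreeGroup.of l ∨ y = (FreeGroup.of l)⁻¹) := by
    obtain ⟨u, y, h1, rfl | ⟨l, hl⟩⟩ := (hα m).exists_eq
    · have h2 := map_conj_rev ((letterParity m).comp (α⁻¹).toMonoidHom) u 1
      rw [← h1] at h2
      simp [letterParity] at h2
    · exact ⟨l, u, y, h1, hl⟩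
  choose τ hτ using h
  have hinj : Function.Injective τ := by
    intro m m' hm
    by_contra hne
    -- A homomorphism to {±1} sees only the middle letter, so τ m = τ m' would force x_m and x_m' to
    -- have the same image under `letterParity m`.
    have h3 (m' : Fin n) : (letterParity m) (FreeGroup.of m')
        = ((letterParity m).comp (α⁻¹).toMonoidHom) (FreeGroup.of (τ m')) := by
      obtain ⟨u, y, h1, hy⟩ := hτ m'
      rw [← map_conj_rev_gen _ u hy, ← h1]
      simp
    have h4 := h3 m
    rw [hm, ← h3 m'] at h4
    simp [letterParity, Ne.symm hne] at h4
  exact ⟨Equiv.ofBijective τ (Finite.injective_iff_bijective.1 hinj), hτ⟩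

/-! ### The affine representations twisted by palindromic automorphisms -/

theorem affineRep_conj_rev (hij : i ≠ j) (u : F n) {y : F n} {c : ℤ × ℤ}
    (hy : ∀ z, affineRep i j y z = z + c) :
    ∃ v, ∀ z, affineRep i j (u * y * rev u) z = z + (c + (2 : ℤ) • v) := by
  obtain ⟨e, v, he, h1, h2⟩ := exists_affineRep_form hij u
  have he2 : e = 1 ∨ e = -1 := mul_self_eq_one_iff.1 he
  -- The composite is the translation by 2v + ec, and for e = -1 one has -c = c + 2(-c).
  refine ⟨v + (if e = 1 then 0 else -c), fun z => ?_⟩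
  rw [affineRep_mul, affineRep_mul, h2, hy, h1]
  rcases he2 with rfl | rfl
  · ext <;> simp <;> ring
  · ext <;> simp <;> ring

theorem affineRep_conj_rev_neg (hij : i ≠ j) (u : F n) {y : F n}
    (hy : ∀ z, affineRep i j y z = -z) (z : ℤ × ℤ) :
    affineRep i j (u * y * rev u) z = -z := by
  obtain ⟨e, v, he, h1, h2⟩ := exists_affineRep_form hij u
  rw [affineRep_mul, affineRep_mul, h2, hy, h1, ← smul_neg, smul_smul, he]
  simp

theorem affineRep_conj_rev_gen (hij : i ≠ j) (u : F n) {y : F n} {l : Fin n}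
    (hy : y = FreeGroup.of l ∨ y = (FreeGroup.of l)⁻¹) {c : ℤ × ℤ}
    (hl : ∀ z, affineRep i j (FreeGroup.of l) z = z + c) :
    ∃ v, ∀ z, affineRep i j (u * y * rev u) z = z + (c + (2 : ℤ) • v) := by
  rcases hy with rfl | rfl
  · exact affineRep_conj_rev hij u hl
  · obtain ⟨v, hv⟩ := affineRep_conj_rev hij u (y := (FreeGroup.of l)⁻¹) (c := -c) (fun z => by
      rw [map_inv, Equiv.Perm.inv_eq_iff_eq, hl, neg_add_cancel_right])
    refine ⟨v - c, fun z => ?_⟩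
    rw [hv]
    ext <;> simp <;> ring

/-- The columns of M are the translation vectors of α(x_i) and α(x_j). The clause on homomorphisms
to {±1} pins down τ, so that the permutations belonging to α and α⁻¹ can be compared; invertibility
of M comes from that comparison. -/
theorem palAut_exists_linearMap {α : MulAut (F n)} (hα : α ∈ palAut n) :
    ∃ τ : Equiv.Perm (Fin n),
      (∀ (f : F n →* ℤˣ) (m : Fin n), f (α (FreeGroup.of m)) = f (FreeGroup.of (τ m))) ∧
      ∀ i j : Fin n, i ≠ j → ∃ M : (ℤ × ℤ) →ₗ[ℤ] (ℤ × ℤ), (∀ z, ∃ y, M z = z + (2 : ℤ) • y) ∧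
      ∀ g z, affineRep (τ i) (τ j) (α g) (M z) = M (affineRep i j g z) := by
  obtain ⟨τ, hτ⟩ := palAut_exists_perm hα
  refine ⟨τ, fun f m => ?_, fun i j hij => ?_⟩
  · obtain ⟨u, y, h, hy⟩ := hτ m
    rw [h, map_conj_rev_gen f u hy]
  have hij' : τ i ≠ τ j := fun h => hij (τ.injective h)
  obtain ⟨ui, yi, hi, hyi⟩ := hτ i
  obtain ⟨uj, yj, hj, hyj⟩ := hτ j
  obtain ⟨v, hv⟩ := affineRep_conj_rev_gen hij' ui hyi affineRep_left
  obtain ⟨v', hv'⟩ := affineRep_conj_rev_gen hij' uj hyj (affineRep_right hij')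
  rw [← hi] at hv
  rw [← hj] at hv'
  let M : (ℤ × ℤ) →ₗ[ℤ] (ℤ × ℤ) :=
    (LinearMap.fst ℤ ℤ ℤ).smulRight ((1, 0) + (2 : ℤ) • v) +
      (LinearMap.snd ℤ ℤ ℤ).smulRight ((0, 1) + (2 : ℤ) • v')
  refine ⟨M, fun z => ⟨z.1 • v + z.2 • v', ?_⟩, intertwines_of_forall_of fun l z => ?_⟩
  · ext <;> simp [M] <;> ring
  · by_cases hli : l = i
    · subst hli
      rw [hv, affineRep_left, map_add]
      simp [M]
    by_cases hlj : l = j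
    · subst hlj
      rw [hv', affineRep_right hij, map_add]
      simp [M]
    obtain ⟨u, y, h, hy⟩ := hτ l
    have hi' : τ l ≠ τ i := fun h => hli (τ.injective h)
    have hj' : τ l ≠ τ j := fun h => hlj (τ.injective h)
    rw [h, affineRep_other hli hlj, map_neg, affineRep_conj_rev_neg hij' u]
    intro z
    rcases hy with rfl | rfl
    · exact affineRep_other hi' hj' z
    · exact affineRep_other_inv hi' hj' z

theorem palAut_exists_intertwines {α : MulAut (F n)} (hα : α ∈ palAut n) (hij : i ≠ j) :
    ∃ i' j' : Fin n, i' ≠ j' ∧ ∃ M ∈ levelTwo, Intertwines i j i' j' α M := by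
  obtain ⟨τ, hτ, H⟩ := palAut_exists_linearMap hα
  obtain ⟨τ', hτ', H'⟩ := palAut_exists_linearMap (inv_mem hα)
  have hinv (m : Fin n) : τ' (τ m) = m := by
    have h1 := hτ ((letterParity m).comp (α⁻¹).toMonoidHom) m
    have h2 := hτ' (letterParity m) (τ m)
    have h3 : letterParity m (FreeGroup.of m) = letterParity m (FreeGroup.of (τ' (τ m))) := by
      rw [← h2]
      simpa using h1
    by_contra hne
    simp [letterParity, hne] at h3
  have hinv' (m : Fin n) : τ (τ' m) = m := by
    rw [← τ'.injective.eq_iff, hinv]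
  have hij' : τ' i ≠ τ' j := fun h => hij (τ'.injective h)
  obtain ⟨M, hM, hM'⟩ := H _ _ hij'
  obtain ⟨N, hN, hN'⟩ := H' _ _ hij
  rw [hinv', hinv'] at hM'
  -- The composite intertwines an action with itself over the trivial automorphism, as the identity
  -- does, so uniqueness applies.
  have h1 : M ∘ₗ N = LinearMap.id := by
    refine eq_of_intertwines (α := 1) hij (fun g z => ?_) fun g z => rfl
    rw [LinearMap.comp_apply, LinearMap.comp_apply, ← hN', ← hM', MulAut.apply_inv_self]
    rfl
  have h2 : N ∘ₗ M = LinearMap.id := by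
    refine eq_of_intertwines (α := 1) hij' (fun g z => ?_) fun g z => rfl
    rw [LinearMap.comp_apply, LinearMap.comp_apply, ← hM', ← hN', MulAut.inv_apply_self]
    rfl
  exact ⟨τ' i, τ' j, hij', LinearEquiv.ofLinearMap M N h1 h2, hM, hM'⟩

end

section
variable {n : ℕ} {i j : Fin n}

/-! ### The homomorphism from the pure palindromic automorphism group to `W` -/

theorem P_apply_self (h : i ≠ j) :
    P i j h (FreeGroup.of i) = FreeGroup.of j * FreeGroup.of i * FreeGroup.of j := by
  simp [P, elemHom]

theorem P_apply_of_ne (h : i ≠ j) {l : Fin n} (hl : l ≠ i) :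
    P i j h (FreeGroup.of l) = FreeGroup.of l := by
  simp [P, elemHom, hl]

theorem P_inv_apply_self (h : i ≠ j) :
    (P i j h)⁻¹ (FreeGroup.of i)
      = (FreeGroup.of j)⁻¹ * FreeGroup.of i * (FreeGroup.of j)⁻¹ := by
  change elemHom i j (-1) (FreeGroup.of i) = _
  simp [elemHom]

theorem P_inv_apply_of_ne (h : i ≠ j) {l : Fin n} (hl : l ≠ i) :
    (P i j h)⁻¹ (FreeGroup.of l) = FreeGroup.of l := by
  change elemHom i j (-1) (FreeGroup.of l) = _
  simp [elemHom, hl]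

theorem inversion_apply_self : inversion i (FreeGroup.of i) = (FreeGroup.of i)⁻¹ := by
  simp [inversion, invHom]

theorem inversion_apply_of_ne {l : Fin n} (hl : l ≠ i) :
    inversion i (FreeGroup.of l) = FreeGroup.of l := by
  simp [inversion, invHom, hl]

/-- `(a, c) ↦ (-a, c)`. -/
def negFst : (ℤ × ℤ) ≃ₗ[ℤ] (ℤ × ℤ) := (LinearEquiv.neg ℤ).prodCongr (LinearEquiv.refl ℤ ℤ)

/-- `(a, c) ↦ (a, -c)`. -/
def negSnd : (ℤ × ℤ) ≃ₗ[ℤ] (ℤ × ℤ) := (LinearEquiv.refl ℤ ℤ).prodCongr (LinearEquiv.neg ℤ)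

theorem negFst_mem : negFst ∈ levelTwo := fun z => ⟨(-z.1, 0), by
  ext <;> simp [negFst]; ring⟩

theorem negSnd_mem : negSnd ∈ levelTwo := fun z => ⟨(0, -z.2), by
  ext <;> simp [negSnd]; ring⟩

theorem actsAs_negFst : ActsAs negFst 1 := actsAs_of_natAbs_eq fun z => by simp [negFst]

theorem actsAs_negSnd : ActsAs negSnd 1 := actsAs_of_natAbs_eq fun z => by simp [negSnd]

theorem Intertwines.of_forall {φ : MulAut (F n)} {M : (ℤ × ℤ) ≃ₗ[ℤ] (ℤ × ℤ)} (hij : i ≠ j)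
    (h1 : ∀ z, affineRep i j (φ (FreeGroup.of i)) z = z + M (1, 0))
    (h2 : ∀ z, affineRep i j (φ (FreeGroup.of j)) z = z + M (0, 1))
    (h3 : ∀ l, l ≠ i → l ≠ j → ∀ z, affineRep i j (φ (FreeGroup.of l)) z = -z) :
    Intertwines i j i j φ M := by
  refine intertwines_of_forall_of (M := M.toLinearMap) fun l z => ?_
  by_cases hi : l = i
  · subst hi
    rw [h1, affineRep_left, map_add]; rfl
  by_cases hj : l = j
  · subst hj
    rw [h2, affineRep_right hij, map_add]; rfl
  rw [h3 l hi hj, affineRep_other hi hj, map_neg]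

theorem intertwines_P_right_left (hij : i ≠ j) :
    Intertwines i j i j (P j i hij.symm) (shearLeft 1) := by
  refine .of_forall hij (fun z => ?_) (fun z => ?_) fun l hi hj z => ?_
  · rw [P_apply_of_ne _ hij, affineRep_left]; simp [shearLeft]
  · simp only [P_apply_self, affineRep_mul, affineRep_left, affineRep_right hij]
    ext <;> simp [shearLeft]; ring
  · rw [P_apply_of_ne _ hj, affineRep_other hi hj]

theorem intertwines_P_left_right (hij : i ≠ j) :
    Intertwines i j i j (P i j hij) (shearRight 1) := by
  refine .of_forall hij (fun z => ?_) (fun z => ?_) fun l hi hj z => ?_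
  · simp only [P_apply_self, affineRep_mul, affineRep_left, affineRep_right hij]
    ext <;> simp [shearRight]; ring
  · rw [P_apply_of_ne _ hij.symm, affineRep_right hij]; simp [shearRight]
  · rw [P_apply_of_ne _ hi, affineRep_other hi hj]

/-- Conjugation by the point reflection x_l inverts the translation x_i, so only a sign changes and
the height does not see it. -/
theorem intertwines_P_left_other (hij : i ≠ j) {l : Fin n} (hil : i ≠ l) (hjl : j ≠ l) :
    Intertwines i j i j (P i l hil) negFst := by
  refine .of_forall hij (fun z => ?_) (fun z => ?_) fun m hi hj z => ?_
  · simp only [P_apply_self, affineRep_mul, affineRep_left, affineRep_other hil.symm hjl.symm]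
    ext <;> simp [negFst]; ring
  · rw [P_apply_of_ne _ hij.symm, affineRep_right hij]; simp [negFst]
  · rw [P_apply_of_ne _ hi, affineRep_other hi hj]

theorem intertwines_P_right_other (hij : i ≠ j) {l : Fin n} (hil : i ≠ l) (hjl : j ≠ l) :
    Intertwines i j i j (P j l hjl) negSnd := by
  refine .of_forall hij (fun z => ?_) (fun z => ?_) fun m hi hj z => ?_
  · rw [P_apply_of_ne _ hij, affineRep_left]; simp [negSnd]
  · simp only [P_apply_self, affineRep_mul, affineRep_right hij,
      affineRep_other hil.symm hjl.symm]
    ext <;> simp [negSnd]; ring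
  · rw [P_apply_of_ne _ hj, affineRep_other hi hj]

theorem intertwines_P_other (hij : i ≠ j) {l m : Fin n} (hil : l ≠ i) (hjl : l ≠ j)
    (hlm : l ≠ m) : Intertwines i j i j (P l m hlm) 1 := by
  refine .of_forall hij (fun z => ?_) (fun z => ?_) fun k hi hj z => ?_
  · rw [P_apply_of_ne _ hil.symm, affineRep_left]; rfl
  · rw [P_apply_of_ne _ hjl.symm, affineRep_right hij]; rfl
  · by_cases hk : k = l
    · subst hk
      have h := affineRep_conj_rev_neg hij (FreeGroup.of m) (affineRep_other hi hj) z
      rwa [P_apply_self, ← rev_of m, rev_of m]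
    · rw [P_apply_of_ne _ hk, affineRep_other hi hj]

theorem intertwines_inversion_left (hij : i ≠ j) : Intertwines i j i j (inversion i) negFst := by
  refine .of_forall hij (fun z => ?_) (fun z => ?_) fun m hi hj z => ?_
  · rw [inversion_apply_self, affineRep_left_inv]
    ext <;> simp [negFst]; ring
  · rw [inversion_apply_of_ne hij.symm, affineRep_right hij]; simp [negFst]
  · rw [inversion_apply_of_ne hi, affineRep_other hi hj]

theorem intertwines_inversion_right (hij : i ≠ j) :
    Intertwines i j i j (inversion j) negSnd := by
  refine .of_forall hij (fun z => ?_) (fun z => ?_) fun m hi hj z => ?_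
  · rw [inversion_apply_of_ne hij, affineRep_left]; simp [negSnd]
  · rw [inversion_apply_self, affineRep_right_inv hij]
    ext <;> simp [negSnd]; ring
  · rw [inversion_apply_of_ne hj, affineRep_other hi hj]

theorem intertwines_inversion_other (hij : i ≠ j) {l : Fin n} (hil : l ≠ i) (hjl : l ≠ j) :
    Intertwines i j i j (inversion l) 1 := by
  refine .of_forall hij (fun z => ?_) (fun z => ?_) fun k hi hj z => ?_
  · rw [inversion_apply_of_ne hil.symm, affineRep_left]; rfl
  · rw [inversion_apply_of_ne hjl.symm, affineRep_right hij]; rfl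
  · by_cases hk : k = l
    · subst hk
      rw [inversion_apply_self, affineRep_other_inv hi hj]
    · rw [inversion_apply_of_ne hk, affineRep_other hi hj]

theorem intertwines_P_trivial (hij : i ≠ j) {a b : Fin n} (hab : a ≠ b)
    (h1 : ¬(a = i ∧ b = j)) (h2 : ¬(a = j ∧ b = i)) :
    ∃ M : levelTwo, Intertwines i j i j (P a b hab) M ∧ ActsAs M 1 := by
  by_cases hai : a = i
  · subst hai
    exact ⟨⟨_, negFst_mem⟩,
      intertwines_P_left_other hij hab fun h => h1 ⟨rfl, h.symm⟩, actsAs_negFst⟩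
  by_cases haj : a = j
  · subst haj
    exact ⟨⟨_, negSnd_mem⟩,
      intertwines_P_right_other hij (fun h => h2 ⟨rfl, h.symm⟩) hab, actsAs_negSnd⟩
  exact ⟨1, intertwines_P_other hij hai haj hab, actsAs_of_natAbs_eq fun _ => ⟨rfl, rfl⟩⟩

theorem intertwines_inversion (hij : i ≠ j) (a : Fin n) :
    ∃ M : levelTwo, Intertwines i j i j (inversion a) M ∧ ActsAs M 1 := by
  by_cases hai : a = i
  · subst hai
    exact ⟨⟨_, negFst_mem⟩, intertwines_inversion_left hij, actsAs_negFst⟩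
  by_cases haj : a = j
  · subst haj
    exact ⟨⟨_, negSnd_mem⟩, intertwines_inversion_right hij, actsAs_negSnd⟩
  exact ⟨1, intertwines_inversion_other hij hai haj, actsAs_of_natAbs_eq fun _ => ⟨rfl, rfl⟩⟩

theorem exists_intertwines_of_mem_purePalAut (hij : i ≠ j) {φ : MulAut (F n)}
    (hφ : φ ∈ purePalAut n) : ∃ M : levelTwo, Intertwines i j i j φ M := by
  induction hφ using Subgroup.closure_induction with
  | mem φ h =>
    rcases h with ⟨a, b, hab, rfl⟩ | ⟨a, rfl⟩
    · by_cases h1 : a = i ∧ b = j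
      · obtain ⟨rfl, rfl⟩ := h1
        exact ⟨⟨_, shearRight_mem 1⟩, intertwines_P_left_right hij⟩
      by_cases h2 : a = j ∧ b = i
      · obtain ⟨rfl, rfl⟩ := h2
        exact ⟨⟨_, shearLeft_mem 1⟩, intertwines_P_right_left hij⟩
      obtain ⟨M, hM, -⟩ := intertwines_P_trivial hij hab h1 h2
      exact ⟨M, hM⟩
    · obtain ⟨M, hM, -⟩ := intertwines_inversion hij a
      exact ⟨M, hM⟩
  | one => exact ⟨1, intertwines_one⟩
  | mul φ ψ _ _ h h' =>
    obtain ⟨M, hM⟩ := h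
    obtain ⟨N, hN⟩ := h'
    exact ⟨M * N, hM.mul hN⟩
  | inv φ _ h =>
    obtain ⟨M, hM⟩ := h
    exact ⟨M⁻¹, hM.inv⟩

/-- The action of the pure palindromic automorphisms on the translation part of `affineRep i j`. -/
noncomputable def pureToLevelTwo (hij : i ≠ j) : purePalAut n →* levelTwo :=
  MonoidHom.mk' (fun φ => (exists_intertwines_of_mem_purePalAut hij φ.2).choose) fun φ ψ =>
    Subtype.ext <| (exists_intertwines_of_mem_purePalAut hij (φ * ψ).2).choose_spec.unique hij
      ((exists_intertwines_of_mem_purePalAut hij φ.2).choose_spec.mul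
        (exists_intertwines_of_mem_purePalAut hij ψ.2).choose_spec)

/-- The homomorphism that maps `P_ji` to `A`, `P_ij` to `B`, and the other generators to `1`. -/
noncomputable def pureToW (hij : i ≠ j) : purePalAut n →* W :=
  levelTwoToW.comp (pureToLevelTwo hij)

theorem pureToW_eq (hij : i ≠ j) {φ : purePalAut n} {M : levelTwo} {w : W}
    (hM : Intertwines i j i j (φ : MulAut (F n)) M) (hw : levelTwoToW M = w) :
    pureToW hij φ = w := by
  have h : pureToLevelTwo hij φ = M := Subtype.ext <|
    (exists_intertwines_of_mem_purePalAut hij φ.2).choose_spec.unique hij hM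
  rw [← hw, ← h]; rfl

theorem pureToW_right_left (hij : i ≠ j) : pureToW hij (pureP j i hij.symm) = A :=
  pureToW_eq hij (M := ⟨_, shearLeft_mem 1⟩) (intertwines_P_right_left hij)
    (levelTwoToW_eq (actsAs_shearLeft (Or.inl rfl)))

theorem pureToW_left_right (hij : i ≠ j) : pureToW hij (pureP i j hij) = B :=
  pureToW_eq hij (M := ⟨_, shearRight_mem 1⟩) (intertwines_P_left_right hij)
    (levelTwoToW_eq (actsAs_shearRight (Or.inl rfl)))

theorem pureToW_of_ne (hij : i ≠ j) {a b : Fin n} (hab : a ≠ b)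
    (h1 : ¬(a = i ∧ b = j)) (h2 : ¬(a = j ∧ b = i)) : pureToW hij (pureP a b hab) = 1 := by
  obtain ⟨M, hM, hw⟩ := intertwines_P_trivial hij hab h1 h2
  exact pureToW_eq hij hM (levelTwoToW_eq hw)

theorem pureToW_inversion (hij : i ≠ j) (a : Fin n) : pureToW hij (pureInversion a) = 1 := by
  obtain ⟨M, hM, hw⟩ := intertwines_inversion hij a
  exact pureToW_eq hij hM (levelTwoToW_eq hw)

theorem pureToW_chi2 {k : Fin n} (hij : i ≠ j) (hik : i ≠ k) (hjk : j ≠ k) :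
    pureToW hij (chi2 i j k hij hik hjk) = (B * A) ^ 2 := by
  rw [chi2, map_pow]
  congr 1
  simp only [map_mul, map_inv, pureToW_right_left, pureToW_left_right]
  rw [pureToW_of_ne, pureToW_of_ne, pureToW_of_ne, pureToW_of_ne, A_inv]
  · simp
  all_goals simp [hik.symm, hjk.symm, hij, hij.symm]

/-! ### The doubled commutator transvections are mapped to `1` -/

theorem levelTwoToW_shearLeft_two {e : ℤ} (he : e = 1 ∨ e = -1) :
    levelTwoToW ⟨shearLeft (e + e), shearLeft_mem _⟩ = 1 := by
  have h : (⟨shearLeft (e + e), shearLeft_mem _⟩ : levelTwo)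
      = ⟨_, shearLeft_mem e⟩ * ⟨_, shearLeft_mem e⟩ := Subtype.ext (shearLeft_add e e)
  rw [h, map_mul, levelTwoToW_eq (actsAs_shearLeft he), A_mul_A]

theorem levelTwoToW_shearRight_two {e : ℤ} (he : e = 1 ∨ e = -1) :
    levelTwoToW ⟨shearRight (e + e), shearRight_mem _⟩ = 1 := by
  have h : (⟨shearRight (e + e), shearRight_mem _⟩ : levelTwo)
      = ⟨_, shearRight_mem e⟩ * ⟨_, shearRight_mem e⟩ := Subtype.ext (shearRight_add e e)
  rw [h, map_mul, levelTwoToW_eq (actsAs_shearRight he), B_mul_B]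

theorem rev_commutator (g h : F n) : rev ⁅g, h⁆ = (rev h)⁻¹ * (rev g)⁻¹ * rev h * rev g := by
  simp [commutatorElement_def, rev_mul, rev_inv, mul_assoc]

/-- The commutator of a translation t with the reflection is t² or t⁻², according to the order, and
that of two reflections is trivial. The reversed commutator contributes the same again, hence the
factor 4. -/
theorem affineRep_rev_commutator_mul (hij : i ≠ j) {a b c : Fin n} (hab : a ≠ b) (hac : a ≠ c)
    (hbc : b ≠ c) (ha : a = i ∨ a = j) : ∃ e : ℤ, (e = 0 ∨ e = 1 ∨ e = -1) ∧
    ∀ z, affineRep i j (rev ⁅FreeGroup.of b, FreeGroup.of c⁆ * FreeGroup.of a *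
      ⁅FreeGroup.of b, FreeGroup.of c⁆) z =
        z + (if a = i then (1, 4 * e) else (4 * e, 1)) := by
  simp only [rev_commutator, rev_of]
  simp only [commutatorElement_def, affineRep_mul]
  have hji := hij.symm
  rcases ha with rfl | rfl
  · have hba := hab.symm
    have hca := hac.symm
    by_cases hb : b = j
    · subst hb
      refine ⟨1, by simp, fun z => ?_⟩
      simp only [affineRep_right hij, affineRep_right_inv hij, affineRep_left,
        affineRep_other hca hbc.symm, affineRep_other_inv hca hbc.symm]
      ext <;> simp; ring
    by_cases hc : c = j
    · subst hc
      refine ⟨-1, by simp, fun z => ?_⟩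
      simp only [affineRep_right hij, affineRep_right_inv hij, affineRep_left,
        affineRep_other hba hbc, affineRep_other_inv hba hbc]
      ext <;> simp; ring
    refine ⟨0, by simp, fun z => ?_⟩
    simp only [affineRep_left, affineRep_other hba hb, affineRep_other_inv hba hb,
      affineRep_other hca hc, affineRep_other_inv hca hc]
    simp
  · have hba := hab.symm
    have hca := hac.symm
    by_cases hb : b = i
    · subst hb
      refine ⟨1, by simp, fun z => ?_⟩
      simp only [affineRep_left, affineRep_left_inv, affineRep_right hij,
        affineRep_other hbc.symm hca, affineRep_other_inv hbc.symm hca]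
      ext <;> simp [hji]; ring
    by_cases hc : c = i
    · subst hc
      refine ⟨-1, by simp, fun z => ?_⟩
      simp only [affineRep_left, affineRep_left_inv, affineRep_right hij,
        affineRep_other hbc hba, affineRep_other_inv hbc hba]
      ext <;> simp [hji]; ring
    refine ⟨0, by simp, fun z => ?_⟩
    simp only [affineRep_right hij, affineRep_other hb hba, affineRep_other_inv hb hba,
      affineRep_other hc hca, affineRep_other_inv hc hca]
    simp [hji]

theorem rev_rev (g : F n) : rev (rev g) = g := by
  rw [← FreeGroup.mk_toWord (x := g), rev_mk, rev_mk, List.reverse_reverse]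

theorem standard_transvection_intertwines (hij : i ≠ j) {φ : MulAut (F n)} {a b c : Fin n}
    (hab : a ≠ b) (hac : a ≠ c) (hbc : b ≠ c)
    (h1 : φ (FreeGroup.of a) = rev ⁅FreeGroup.of b, FreeGroup.of c⁆ * FreeGroup.of a *
      ⁅FreeGroup.of b, FreeGroup.of c⁆)
    (h2 : ∀ l, l ≠ a → φ (FreeGroup.of l) = FreeGroup.of l) :
    ∃ M : levelTwo, Intertwines i j i j φ M ∧ levelTwoToW M = 1 := by
  by_cases hai : a = i
  · obtain ⟨e, he, h⟩ := affineRep_rev_commutator_mul hij hab hac hbc (Or.inl hai)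
    subst hai
    -- The parameter of a shear is half its off-diagonal entry, so 4e is the parameter e + e: the
    -- square of an elementary matrix or its inverse.
    refine ⟨⟨shearRight (e + e), shearRight_mem _⟩, .of_forall hij (fun z => ?_) (fun z => ?_)
      fun l hl hl' z => ?_, ?_⟩
    · rw [h1, h]
      ext <;> simp [shearRight]; ring
    · rw [h2 _ hij.symm, affineRep_right hij]
      simp [shearRight]
    · rw [h2 _ hl, affineRep_other hl hl']
    · rcases he with rfl | he
      · exact levelTwoToW_eq (actsAs_of_natAbs_eq fun z => by simp [shearRight])
      · exact levelTwoToW_shearRight_two he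
  by_cases haj : a = j
  · obtain ⟨e, he, h⟩ := affineRep_rev_commutator_mul hij hab hac hbc (Or.inr haj)
    subst haj
    refine ⟨⟨shearLeft (e + e), shearLeft_mem _⟩, .of_forall hij (fun z => ?_) (fun z => ?_)
      fun l hl hl' z => ?_, ?_⟩
    · rw [h2 _ hij, affineRep_left]
      simp [shearLeft]
    · rw [h1, h]
      ext <;> simp [shearLeft, hai]; ring
    · rw [h2 _ hl', affineRep_other hl hl']
    · rcases he with rfl | he
      · exact levelTwoToW_eq (actsAs_of_natAbs_eq fun z => by simp [shearLeft])
      · exact levelTwoToW_shearLeft_two he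
  refine ⟨1, .of_forall hij (fun z => ?_) (fun z => ?_) fun l hl hl' z => ?_, map_one _⟩
  · rw [h2 _ (Ne.symm hai), affineRep_left]; rfl
  · rw [h2 _ (Ne.symm haj), affineRep_right hij]; rfl
  · by_cases hla : l = a
    · subst hla
      have h := affineRep_conj_rev_neg hij (rev ⁅FreeGroup.of b, FreeGroup.of c⁆)
        (affineRep_other hl hl') z
      rwa [rev_rev, ← h1] at h
    · rw [h2 _ hla, affineRep_other hl hl']

/-- Conjugation by α reduces to a standard transvection, possibly for another pair i', j'. The
matrix M of α still lies in the level two group, so conjugation by it preserves the kernel of the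
map to W. -/
theorem IsDoubledCommutatorTransvection.exists_intertwines (hij : i ≠ j) {φ : MulAut (F n)}
    (hφ : IsDoubledCommutatorTransvection φ) :
    ∃ M : levelTwo, Intertwines i j i j φ M ∧ levelTwoToW M = 1 := by
  obtain ⟨-, α, hα, a, b, c, hab, hac, hbc, h1, h2⟩ := hφ
  obtain ⟨i', j', hij', M, hM, hM'⟩ := palAut_exists_intertwines hα hij
  obtain ⟨N, hN, hN1⟩ := standard_transvection_intertwines hij' (φ := α⁻¹ * φ * α) hab hac hbc
    (by
      rw [MulAut.mul_apply, MulAut.mul_apply, h1, ← map_commutatorElement, rev_map α hα,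
        ← map_mul, ← map_mul, MulAut.inv_apply_self])
    (fun l hl => by rw [MulAut.mul_apply, MulAut.mul_apply, h2 l hl, MulAut.inv_apply_self])
  refine ⟨⟨M, hM⟩ * N * ⟨M, hM⟩⁻¹, ?_, ?_⟩
  · have h := (hM'.mul hN).mul hM'.inv
    rwa [← mul_assoc, mul_inv_cancel_left, mul_inv_cancel_right] at h
  · rw [map_mul, map_mul, hN1, mul_one, map_inv, mul_inv_cancel]

/-- Stated through matrices, which avoids having to show that these automorphisms are pure. -/
theorem exists_intertwines_of_mem_doubledCommutatorSubgroup (hij : i ≠ j) {φ : MulAut (F n)}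
    (hφ : φ ∈ doubledCommutatorSubgroup n) :
    ∃ M : levelTwo, Intertwines i j i j φ M ∧ levelTwoToW M = 1 := by
  induction hφ using Subgroup.closure_induction with
  | mem φ h => exact IsDoubledCommutatorTransvection.exists_intertwines hij h
  | one => exact ⟨1, intertwines_one, map_one _⟩
  | mul φ ψ _ _ h h' =>
    obtain ⟨M, hM, hM1⟩ := h
    obtain ⟨N, hN, hN1⟩ := h'
    exact ⟨M * N, hM.mul hN, by rw [map_mul, hM1, hN1, one_mul]⟩
  | inv φ _ h =>
    obtain ⟨M, hM, hM1⟩ := h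
    exact ⟨M⁻¹, hM.inv, by rw [map_inv, hM1, inv_one]⟩

theorem pureToW_of_mem_doubledCommutatorSubgroup (hij : i ≠ j) {φ : purePalAut n}
    (hφ : (φ : MulAut (F n)) ∈ doubledCommutatorSubgroup n) : pureToW hij φ = 1 := by
  obtain ⟨M, hM, hM1⟩ := exists_intertwines_of_mem_doubledCommutatorSubgroup hij hφ
  exact pureToW_eq hij hM hM1

/-! ### `χ₂` is in the palindromic Torelli group -/

theorem P_mem_palAut (h : i ≠ j) : P i j h ∈ palAut n := by
  intro l
  rw [isPalindrome_iff]
  by_cases hl : l = i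
  · subst hl
    simp [P_apply_self, rev_mul, rev_of, mul_assoc]
  · rw [P_apply_of_ne h hl, rev_of]

/-- A homomorphism to an additive commutative group, evaluated on the basis. -/
def basisValues {C : Type*} [AddCommGroup C] (f : F n →* Multiplicative C) (l : Fin n) : C :=
  (f (FreeGroup.of l)).toAdd

section
variable {C : Type*} [AddCommGroup C]

theorem basisValues_comp_P (f : F n →* Multiplicative C) (h : i ≠ j) :
    basisValues (f.comp (P i j h).toMonoidHom)
      = Function.update (basisValues f) i (basisValues f i + (2 : ℤ) • basisValues f j) := by
  funext l
  by_cases hl : l = i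
  · subst hl
    simp [basisValues, P_apply_self]
    abel
  · simp [basisValues, P_apply_of_ne h hl, hl]

theorem basisValues_comp_P_inv (f : F n →* Multiplicative C) (h : i ≠ j) :
    basisValues (f.comp (P i j h)⁻¹.toMonoidHom)
      = Function.update (basisValues f) i (basisValues f i - (2 : ℤ) • basisValues f j) := by
  funext l
  change (f ((P i j h)⁻¹ (FreeGroup.of l))).toAdd = _
  by_cases hl : l = i
  · subst hl
    rw [P_inv_apply_self]
    simp [basisValues]
    abel
  · rw [P_inv_apply_of_ne h hl]
    simp [basisValues, hl]

theorem comp_mul_toMonoidHom (f : F n →* Multiplicative C) (φ ψ : MulAut (F n)) :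
    f.comp (φ * ψ).toMonoidHom = (f.comp φ.toMonoidHom).comp ψ.toMonoidHom := rfl

theorem basisValues_comp_chi2 (f : F n →* Multiplicative C) {k : Fin n} (hij : i ≠ j)
    (hik : i ≠ k) (hjk : j ≠ k) :
    basisValues (f.comp (chi2 i j k hij hik hjk : MulAut (F n)).toMonoidHom)
      = basisValues f := by
  -- The automorphism squared in χ₂ acts on the abelianisation as an involution. Its action is
  -- needed for all f, since it is applied twice.
  have h (f : F n →* Multiplicative C) :
      basisValues (f.comp (P j k hjk * (P i k hik)⁻¹ * P k i hik.symm * P k j hjk.symm *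
        P i j hij * (P j i hij.symm)⁻¹).toMonoidHom) = fun l =>
      if l = i then basisValues f i + (2 : ℤ) • basisValues f j + (2 : ℤ) • basisValues f k
      else if l = j then (-2 : ℤ) • basisValues f i - (3 : ℤ) • basisValues f j -
        (2 : ℤ) • basisValues f k
      else if l = k then (2 : ℤ) • basisValues f i + (2 : ℤ) • basisValues f j + basisValues f k
      else basisValues f l := by
    simp only [comp_mul_toMonoidHom, basisValues_comp_P, basisValues_comp_P_inv]
    funext l
    by_cases hi : l = i
    · subst hi
      simp [hij, hik, hjk, hij.symm, hik.symm, hjk.symm]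
      abel
    by_cases hj : l = j
    · subst hj
      simp [hij, hik, hjk, hij.symm, hik.symm, hjk.symm]
      abel
    by_cases hk : l = k
    · subst hk
      simp [hij, hik, hjk, hij.symm, hik.symm, hjk.symm]
      abel
    simp [hi, hj, hk]
  have h2 : (chi2 i j k hij hik hjk : MulAut (F n)) = (P j k hjk * (P i k hik)⁻¹ *
      P k i hik.symm * P k j hjk.symm * P i j hij * (P j i hij.symm)⁻¹) ^ 2 := rfl
  rw [h2, pow_two, comp_mul_toMonoidHom, h, h]
  funext l
  by_cases hi : l = i
  · subst hi
    simp [hij.symm, hik.symm, hjk.symm]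
    abel
  by_cases hj : l = j
  · subst hj
    simp [hij.symm, hik.symm, hjk.symm]
    abel
  by_cases hk : l = k
  · subst hk
    simp [hij.symm, hik.symm, hjk.symm]
    abel
  simp [hi, hj, hk]

end

theorem chi2_mem_palTorelli {k : Fin n} (hij : i ≠ j) (hik : i ≠ k) (hjk : j ≠ k) :
    (chi2 i j k hij hik hjk : MulAut (F n)) ∈ palTorelli n := by
  constructor
  · exact pow_mem (mul_mem (mul_mem (mul_mem (mul_mem (mul_mem (P_mem_palAut hjk)
      (inv_mem (P_mem_palAut hik))) (P_mem_palAut hik.symm)) (P_mem_palAut hjk.symm))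
      (P_mem_palAut hij)) (inv_mem (P_mem_palAut hij.symm))) 2
  · intro g
    let f : F n →* Multiplicative (Additive (Abelianization (F n))) := Abelianization.of
    have h : f.comp (chi2 i j k hij hik hjk : MulAut (F n)).toMonoidHom = f :=
      FreeGroup.ext_hom _ _ fun l => congrFun (basisValues_comp_chi2 f hij hik hjk) l
    exact DFunLike.congr_fun h g

theorem doubledCommutatorSubgroup_le : doubledCommutatorSubgroup n ≤ palTorelli n :=
  (Subgroup.closure_le _).2 fun _ h => h.1

theorem chi2_notMem {k : Fin n} (hij : i ≠ j) (hik : i ≠ k) (hjk : j ≠ k) :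
    (chi2 i j k hij hik hjk : MulAut (F n)) ∉ doubledCommutatorSubgroup n := fun h =>
  sq_B_mul_A_ne_one <| by
    rw [← pureToW_chi2 hij hik hjk, pureToW_of_mem_doubledCommutatorSubgroup hij h]

/-! ### The presented group -/

open Classical in
/-- The images of the formal generators under `σ`. -/
noncomputable def genToW (i j : Fin n) : Gen n → W
  | .S a b _ => if a = i ∧ b = j then A else if a = j ∧ b = i then B else 1
  | .O _ => 1

theorem lift_genToW_fS_sq (a b : Fin n) (h : a ≠ b) :
    FreeGroup.lift (genToW i j) (fS a b h) ^ 2 = 1 := by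
  simp only [fS, FreeGroup.lift_apply_of, genToW]
  split_ifs <;> simp [pow_two, A_mul_A, B_mul_B]

theorem lift_genToW_fO (a : Fin n) : FreeGroup.lift (genToW i j) (fO a) = 1 := by
  simp [fO, genToW]

/-- Only A and B fail to commute among the images, and they come only from the opposite pair S_ij,
S_ji. -/
theorem lift_genToW_commutator {a b c d : Fin n} (h : a ≠ b) (h' : c ≠ d)
    (h1 : ¬(a = d ∧ b = c)) :
    ⁅FreeGroup.lift (genToW i j) (fS a b h), FreeGroup.lift (genToW i j) (fS c d h')⁆ = 1 := by
  simp only [fS, FreeGroup.lift_apply_of, genToW]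
  split_ifs <;> simp_all

/-- Each O_a goes to 1 and each S_ab to an element of square 1, so what survives is a commutator of
two S's that are not opposite; in (9) the factor S_ca⁻² disappears. -/
theorem lift_genToW_relator {r : FreeGroup (Gen n)} (h : Relator n r) :
    FreeGroup.lift (genToW i j) r = 1 := by
  cases h <;> simp only [map_pow, map_mul, map_inv, map_commutatorElement, lift_genToW_fO,
    lift_genToW_fS_sq, one_mul, one_pow, commutatorElement_one_left, inv_one, mul_one]
  all_goals refine lift_genToW_commutator _ _ ?_
  all_goals exact fun h => absurd h.1 (by assumption)

/-- The homomorphism that maps `S_ij` to `A`, `S_ji` to `B`, and the other generators to `1`. -/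
noncomputable def presentedToW (i j : Fin n) : Q n →* W :=
  PresentedGroup.toGroup (f := genToW i j) fun _ h => lift_genToW_relator h

theorem presentedToW_qS (a b : Fin n) (h : a ≠ b) [Decidable (a = i ∧ b = j)]
    [Decidable (a = j ∧ b = i)] : presentedToW i j (qS a b h) =
      if a = i ∧ b = j then A else if a = j ∧ b = i then B else 1 := by
  rw [presentedToW, qS, PresentedGroup.toGroup.of, genToW]
  congr

theorem presentedToW_qO (a : Fin n) : presentedToW i j (qO a) = 1 :=
  PresentedGroup.toGroup.of _

theorem presentedToW_xi {k : Fin n} (hij : i ≠ j) (hik : i ≠ k) (hjk : j ≠ k) :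
    presentedToW i j (xi i j k hij hik hjk) = (B * A) ^ 2 := by
  simp [xi, presentedToW_qS, hij.symm, hik.symm, hjk.symm, A_inv]

end

end PalTorelli

theorem mainTheorem8 (n : ℕ) (hn : 3 ≤ n) :
    PalTorelli.doubledCommutatorSubgroup n < PalTorelli.palTorelli n ∧
    ∀ (i j k : Fin n) (hij : i ≠ j) (hik : i ≠ k) (hjk : j ≠ k),
      ((PalTorelli.chi2 i j k hij hik hjk : MulAut (PalTorelli.F n)) ∈ PalTorelli.palTorelli n ∧
        (PalTorelli.chi2 i j k hij hik hjk : MulAut (PalTorelli.F n)) ∉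
          PalTorelli.doubledCommutatorSubgroup n) ∧
      (∃ ρ : PalTorelli.purePalAut n →* PalTorelli.W,
        Function.Surjective ρ ∧
        (∀ φ : PalTorelli.purePalAut n,
          (φ : MulAut (PalTorelli.F n)) ∈ PalTorelli.doubledCommutatorSubgroup n → ρ φ = 1) ∧
        ρ (PalTorelli.pureP j i hij.symm) = PalTorelli.A ∧
        ρ (PalTorelli.pureP i j hij) = PalTorelli.B ∧
        (∀ (a b : Fin n) (hab : a ≠ b), ¬(a = i ∧ b = j) → ¬(a = j ∧ b = i) →
          ρ (PalTorelli.pureP a b hab) = 1) ∧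
        (∀ a : Fin n, ρ (PalTorelli.pureInversion a) = 1) ∧
        ρ (PalTorelli.chi2 i j k hij hik hjk) ≠ 1) ∧
      (∃ σ : PalTorelli.Q n →* PalTorelli.W,
        Function.Surjective σ ∧
        σ (PalTorelli.qS i j hij) = PalTorelli.A ∧
        σ (PalTorelli.qS j i hij.symm) = PalTorelli.B ∧
        (∀ (a b : Fin n) (hab : a ≠ b), ¬(a = i ∧ b = j) → ¬(a = j ∧ b = i) →
          σ (PalTorelli.qS a b hab) = 1) ∧
        (∀ a : Fin n, σ (PalTorelli.qO a) = 1) ∧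
        σ (PalTorelli.xi i j k hij hik hjk) ≠ 1) := by
  open PalTorelli in
  constructor
  · refine lt_of_le_of_ne doubledCommutatorSubgroup_le fun h => ?_
    have h01 : (⟨0, by omega⟩ : Fin n) ≠ ⟨1, by omega⟩ := by simp
    have h02 : (⟨0, by omega⟩ : Fin n) ≠ ⟨2, by omega⟩ := by simp
    have h12 : (⟨1, by omega⟩ : Fin n) ≠ ⟨2, by omega⟩ := by simp
    -- This is where n ≥ 3 enters: χ₂ needs three different indices.
    exact chi2_notMem h01 h02 h12 (h ▸ chi2_mem_palTorelli h01 h02 h12)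
  · intro i j k hij hik hjk
    have hA : presentedToW i j (qS i j hij) = A := by simp [presentedToW_qS]
    have hB : presentedToW i j (qS j i hij.symm) = B := by simp [presentedToW_qS, hij.symm]
    refine ⟨⟨chi2_mem_palTorelli hij hik hjk, chi2_notMem hij hik hjk⟩,
      ⟨pureToW hij, surjective_of_A_of_B _ (pureToW_right_left hij) (pureToW_left_right hij),
        fun φ hφ => pureToW_of_mem_doubledCommutatorSubgroup hij hφ, pureToW_right_left hij,
        pureToW_left_right hij, fun a b hab => pureToW_of_ne hij hab, pureToW_inversion hij, ?_⟩,
      ⟨presentedToW i j, surjective_of_A_of_B _ hA hB, hA, hB, fun a b hab h1 h2 => ?_,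
        presentedToW_qO, ?_⟩⟩
    · rw [pureToW_chi2]
      exact sq_B_mul_A_ne_one
    · rw [presentedToW_qS, if_neg h1, if_neg h2]
    · rw [presentedToW_xi]
      exact sq_B_mul_A_ne_one
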